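/- Let $q$ be a prime power and $F=\mathbb F_q$. The split octonion algebra $\mathbb O$ over $F$ has basis $\{e_i : i\in\pm I\}$, $I=\{0,1,\omega,\bar\omega\}$ (with $\omega\cdot\omega=\bar\omega$, $\omega\bar\omega=1$, and $-0\neq 0$), with products $e_1e_\omega=-e_\omega e_1=e_{-\bar\omega}$, $e_1e_0=e_{-0}e_1=e_1$, $e_{-1}e_1=-e_0$, $e_0e_0=e_0$, their images under negating all subscripts and under multiplying all subscripts by $\omega$, and all other products of basis vectors $0$. Put $\mathrm{Tr}(\sum\lambda_ie_i)=\lambda_0+\lambda_{-0}$ and $N(\sum\lambda_ie_i)=\sum_{i\in I}\lambda_i\lambda_{-i}$. Let $\mathbb J$ be the $27$-dimensional space of $3\times 3$ Hermitian octonion matrices $(a,b,c\mid A,B,C)$ with $a,b,c\in F$ and $A,B,C\in\mathbb O$, with the cubic form $$\det(a,b,c\mid A,B,C)=abc-aN(A)-bN(B)-cN(C)+\mathrm{Tr}(ABC),$$ and let $\mathcal G=SE_6(q)$ be the group of all $F$-linear automorphisms of $\mathbb J$ that preserve this cubic form. A nonzero $W\in\mathbb J$ is white if the linear term of the polynomial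 $\det(W+X)$ in the coordinates of $X$ is identically zero; a white point is a $1$-dimensional subspace spanned by a white vector. Let $\mathrm{SO}_{10}^+(q)$ be the special orthogonal group of the plus type quadratic form $Q$ on $F^{10}$ if $q$ is odd, and let it mean $\Omega_{10}^+(q)$ (the products of even numbers of reflections) if $q$ is even. For $q$ odd let $\mathrm{PGSO}_{10}^+(q)$ be the group of all linear maps $g$ of $F^{10}$ with $Q(gx)=\mu Q(x)$ for all $x$ and $\det g=\mu^5$, for some $\mu\in F^\times$, modulo the scalars. Theorem. Let $S$ be the stabilizer in $\mathcal G$ of a white point. Then $S$ has normal subgroups $N_1\le N_2$ such that (a) $N_1$ is isomorphic to a subgroup of the additive group of $F^{16}$ (which is elementary abelian of order $q^{16}$); (b) $N_2/N_1$ is isomorphic to a subgroup of the cyclic group $C_{q-1}$; (c) $|S/N_2|\le|\mathrm{SO}_{10}^+(q)|$, and $S/N_2$ is isomorphic to a subgroup of $\mathrm{SO}_{10}^+(q)=\Omega_{10}^+(q)$ if $q$ is even, and of $\mathrm{PGSO}_{10}^+(q)$ if $q$ is odd. In particular $S$ is at most as large as a group of shape $q^{16}.C_{q-1}.\mathrm{SO}_{10}^+(q)$: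 $$|S|\le q^{16}\,(q-1)\,|\mathrm{SO}_{10}^+(q)|.$$ -/

import Mathlib

/-- Indices of the standard basis of the split octonions: the set `±I`, with
`I = {0, 1, ω, ω²}`.  The Boolean is the sign (`true` for plus), `none` is the index `0`,
and `some k` is `ω ^ k`. -/
abbrev OctIdx : Type := Bool × Option (Fin 3)

/-- The product of two basis octonions, as a coefficient and a basis index.  It is given by
`e₁ e_ω = -e_ω e₁ = e_{-ω²}`, `e₁ e₀ = e_{-0} e₁ = e₁`, `e_{-1} e₁ = -e₀`, `e₀ e₀ = e₀`,
and by all images of these under negating all indices and multiplying all indices by `ω`;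
all the other products are `0`. -/
def octBasisMul : OctIdx → OctIdx → ℤ × OctIdx
  | (s, none), (t, none) => (if s = t then 1 else 0, (s, none))
  | (s, some k), (t, none) => (if s = t then 1 else 0, (s, some k))
  | (s, none), (t, some k) => (if s = t then 0 else 1, (t, some k))
  | (s, some k), (t, some l) =>
      if s = t then
        (if l = k + 1 then (1, (!s, some (k + 2)))
          else if l = k + 2 then (-1, (!s, some (k + 1)))
          else (0, (s, none)))
      else (if k = l then -1 else 0, (t, none))

/-- The split octonions over `R`, in coordinates with respect to the basis `e_i`, `i ∈ ±I`. -/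
abbrev SplitOct (R : Type*) : Type _ := OctIdx → R

/-- The bilinear multiplication of the split octonions. -/
def octMul {R : Type*} [CommRing R] (x y : SplitOct R) : SplitOct R := fun k =>
  ∑ i, ∑ j, if (octBasisMul i j).2 = k then ((octBasisMul i j).1 : R) * (x i * y j) else 0

/-- The trace `λ₀ + λ_{-0}`. -/
def octTrace {R : Type*} [CommRing R] (x : SplitOct R) : R := x (true, none) + x (false, none)

/-- The conjugation: it swaps `e₀` and `e_{-0}`, and negates all the other `e_i`. -/
def octConj {R : Type*} [CommRing R] (x : SplitOct R) : SplitOct R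
  | (s, none) => x (!s, none)
  | (s, some k) => -x (s, some k)

/-- The norm `∑_{i ∈ I} λ_i λ_{-i}`. -/
def octNorm {R : Type*} [CommRing R] (x : SplitOct R) : R :=
  ∑ k : Option (Fin 3), x (true, k) * x (false, k)

/-- The norm of `x` is `x` times its conjugate, a scalar multiple of `1 = e₀ + e_{-0}`. -/
theorem octMul_octConj {R : Type*} [CommRing R] (x : SplitOct R) :
    octMul x (octConj x) = fun i => if i.2 = none then octNorm x else 0 := by
  funext ⟨s, k⟩
  rcases s with _ | _ <;> rcases k with _ | k <;> (try fin_cases k) <;>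
  simp [octMul, octNorm, octConj, octBasisMul, Fintype.sum_prod_type, Fintype.sum_option,
    Fin.sum_univ_three] <;> ring

/-- Indices of the 27 coordinates `(a, b, c ∣ A, B, C)` of a Hermitian octonion matrix: first
the three scalars `a, b, c`, then the coordinates of the three octonions `A, B, C`. -/
abbrev AlbertIdx : Type := Fin 3 ⊕ (Fin 3 × OctIdx)

/-- The 27-dimensional space of `3 × 3` Hermitian matrices `(a, b, c ∣ A, B, C)`, with rows
`(a, C, B̄)`, `(C̄, b, A)`, `(B, Ā, c)`, where `a, b, c ∈ R` and `A, B, C` are split octonions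
over `R`. -/
abbrev Albert (R : Type*) : Type _ := AlbertIdx → R

/-- The scalar entries `a, b, c` of `(a, b, c ∣ A, B, C)`. -/
def albertDiag {R : Type*} (X : Albert R) (n : Fin 3) : R := X (Sum.inl n)

/-- The octonion entries `A, B, C` of `(a, b, c ∣ A, B, C)`. -/
def albertOff {R : Type*} (X : Albert R) (n : Fin 3) : SplitOct R := fun i => X (Sum.inr (n, i))

/-- The Dickson–Freudenthal determinant `abc - aAĀ - bBB̄ - cCC̄ + Tr(ABC)`. -/
def albertDet {R : Type*} [CommRing R] (X : Albert R) : R :=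
  albertDiag X 0 * albertDiag X 1 * albertDiag X 2
    - albertDiag X 0 * octNorm (albertOff X 0)
    - albertDiag X 1 * octNorm (albertOff X 1)
    - albertDiag X 2 * octNorm (albertOff X 2)
    + octTrace (octMul (octMul (albertOff X 0) (albertOff X 1)) (albertOff X 2))

theorem octMul_map {R S : Type*} [CommRing R] [CommRing S] (f : R →+* S) (x y : SplitOct R) :
    octMul (fun i => f (x i)) (fun i => f (y i)) = fun i => f (octMul x y i) := by
  funext k
  simp only [octMul, map_sum]
  refine Finset.sum_congr rfl fun i _ => Finset.sum_congr rfl fun j _ => ?_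
  split_ifs <;> simp

theorem albertDet_map {R S : Type*} [CommRing R] [CommRing S] (f : R →+* S) (X : Albert R) :
    albertDet (fun i => f (X i)) = f (albertDet X) := by
  have h (n : Fin 3) : albertOff (fun i => f (X i)) n = fun i => f (albertOff X n i) := rfl
  have h' (n : Fin 3) : albertDiag (fun i => f (X i)) n = f (albertDiag X n) := rfl
  simp only [albertDet, h, h', octMul_map, octTrace, octNorm, map_add, map_sub, map_mul, map_sum]

/-- A nonzero vector `W` is white if the linear term of the polynomial `det (W + X)` in the 27
coordinates of `X` is identically zero. -/
def IsWhite {F : Type*} [Field F] (W : Albert F) : Prop :=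
  W ≠ 0 ∧
    MvPolynomial.homogeneousComponent 1
      (albertDet fun i => MvPolynomial.C (W i) + (MvPolynomial.X i : MvPolynomial AlbertIdx F)) = 0

/-- A white point is a 1-dimensional subspace spanned by a white vector. -/
def IsWhitePoint {F : Type*} [Field F] (P : Submodule F (Albert F)) : Prop :=
  ∃ W, IsWhite W ∧ P = Submodule.span F {W}

/-- The extension of scalars of a linear map to vectors with coordinates in an `F`-algebra. -/
def albertExtend {F A : Type*} [Field F] [CommRing A] [Algebra F A]
    (g : Albert F ≃ₗ[F] Albert F) (v : Albert A) : Albert A := fun i =>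
  ∑ j, algebraMap F A (g (Pi.single j 1) i) * v j

/-- `g` preserves the determinant, as a cubic form in 27 variables. -/
def PreservesDet {F : Type*} [Field F] (g : Albert F ≃ₗ[F] Albert F) : Prop :=
  albertDet (albertExtend g (MvPolynomial.X : AlbertIdx → MvPolynomial AlbertIdx F)) =
    albertDet (MvPolynomial.X : AlbertIdx → MvPolynomial AlbertIdx F)

theorem PreservesDet.extend {F A : Type*} [Field F] [CommRing A] [Algebra F A]
    {g : Albert F ≃ₗ[F] Albert F} (hg : PreservesDet g) (v : Albert A) :
    albertDet (albertExtend g v) = albertDet v := by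
  have h := congrArg (MvPolynomial.aeval v).toRingHom hg
  rw [← albertDet_map, ← albertDet_map] at h
  have e (i : AlbertIdx) : (MvPolynomial.aeval v).toRingHom
      (albertExtend g (MvPolynomial.X : AlbertIdx → MvPolynomial AlbertIdx F) i) =
      albertExtend g v i := by
    simp only [albertExtend, map_sum, map_mul]
    refine Finset.sum_congr rfl fun j _ => ?_
    simp
  have e' (i : AlbertIdx) : (MvPolynomial.aeval v).toRingHom
      (MvPolynomial.X i : MvPolynomial AlbertIdx F) = v i := by simp
  simpa only [e, e'] using h

theorem albertExtend_one {F A : Type*} [Field F] [CommRing A] [Algebra F A] (v : Albert A) :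
    albertExtend (1 : Albert F ≃ₗ[F] Albert F) v = v := by
  funext i
  simp [albertExtend, Pi.single_apply]

theorem albertExtend_mul {F A : Type*} [Field F] [CommRing A] [Algebra F A]
    (g h : Albert F ≃ₗ[F] Albert F) (v : Albert A) :
    albertExtend (g * h) v = albertExtend g (albertExtend h v) := by
  funext i
  have key (j : AlbertIdx) : g (h (Pi.single j 1)) i =
      ∑ k, g (Pi.single k 1) i * h (Pi.single j 1) k := by
    conv_lhs => rw [← Finset.univ_sum_single (h (Pi.single j 1))]
    rw [map_sum, Finset.sum_apply]
    refine Finset.sum_congr rfl fun k _ => ?_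
    have : (Pi.single k (h (Pi.single j 1) k) : Albert F) =
        h (Pi.single j 1) k • Pi.single k 1 := by
      rw [← Pi.single_smul]; simp
    rw [this, map_smul, Pi.smul_apply, smul_eq_mul, mul_comm]
  simp only [albertExtend, LinearEquiv.mul_apply, key, map_sum, map_mul, Finset.sum_mul,
    Finset.mul_sum]
  rw [Finset.sum_comm]
  simp only [mul_assoc]

/-- The group of all linear automorphisms of the 27-space that preserve the determinant. -/
def SE6 (F : Type*) [Field F] : Subgroup (Albert F ≃ₗ[F] Albert F) where
  carrier := {g | PreservesDet g}
  one_mem' := by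
    simp only [Set.mem_ofPred_eq, PreservesDet, albertExtend_one]
  mul_mem' := by
    intro g h hg hh
    simp only [Set.mem_ofPred_eq] at hg hh ⊢
    unfold PreservesDet
    rw [albertExtend_mul, hg.extend, hh.extend]
  inv_mem' := by
    intro g hg
    simp only [Set.mem_ofPred_eq] at hg ⊢
    unfold PreservesDet
    rw [← hg.extend, ← albertExtend_mul, mul_inv_cancel, albertExtend_one]

/-- The stabilizer of the subspace `P` in the group `SE6 F`. -/
def SE6Stabilizer {F : Type*} [Field F] (P : Submodule F (Albert F)) : Subgroup (SE6 F) where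
  carrier := {g | P.map (g : Albert F ≃ₗ[F] Albert F).toLinearMap = P}
  one_mem' := Submodule.map_id P
  mul_mem' := by
    intro g h hg hh
    have : ((g * h : SE6 F) : Albert F ≃ₗ[F] Albert F).toLinearMap =
      (g : Albert F ≃ₗ[F] Albert F).toLinearMap ∘ₗ
        (h : Albert F ≃ₗ[F] Albert F).toLinearMap := rfl
    simp only [Set.mem_ofPred_eq] at hg hh ⊢
    rw [this, Submodule.map_comp, hh, hg]
  inv_mem' := by
    intro g hg
    have : ((g⁻¹ : SE6 F) : Albert F ≃ₗ[F] Albert F).toLinearMap ∘ₗ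
      (g : Albert F ≃ₗ[F] Albert F).toLinearMap = LinearMap.id :=
      LinearMap.ext fun x => LinearEquiv.symm_apply_apply (g : Albert F ≃ₗ[F] Albert F) x
    simp only [Set.mem_ofPred_eq] at hg ⊢
    conv_lhs => rw [← hg]
    rw [← Submodule.map_comp, this, Submodule.map_id]

/-- The standard 10-dimensional space over `F`, as the sum of five hyperbolic planes. -/
abbrev Space10 (F : Type*) : Type _ := Fin 5 × Bool → F

/-- The hyperbolic (plus type) quadratic form on the standard 10-dimensional space. -/
def form10 {F : Type*} [Field F] (x : Space10 F) : F := ∑ i, x (i, true) * x (i, false)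

/-- The full orthogonal group of the plus type form in dimension 10. -/
def O10 (F : Type*) [Field F] : Subgroup (Space10 F ≃ₗ[F] Space10 F) where
  carrier := {g | ∀ x, form10 (g x) = form10 x}
  one_mem' := fun _ => rfl
  mul_mem' := fun {g h} hg hh x => (hg (h x)).trans (hh x)
  inv_mem' := fun {g} hg x => by
    rw [← hg (g⁻¹ x)]
    exact congrArg form10 (LinearEquiv.apply_symm_apply g x)

/-- The reflections `x ↦ x - (B(x,u) / Q(u)) u` in the vectors `u` with `Q(u) ≠ 0`, where
`B(x,u) = Q(x+u) - Q(x) - Q(u)`.  In characteristic 2 they are the orthogonal transvections. -/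
def IsReflection10 {F : Type*} [Field F] (g : Space10 F ≃ₗ[F] Space10 F) : Prop :=
  ∃ u : Space10 F, form10 u ≠ 0 ∧
    ∀ x, g x = x - (QuadraticMap.polar form10 x u / form10 u) • u

/-- The group `SO₁₀⁺`.  In characteristic different from 2, it is the group of the orthogonal
maps of determinant 1.  In characteristic 2, it is understood to be `Ω₁₀⁺`, the subgroup of index
2 in the orthogonal group that consists of the products of even numbers of reflections. -/
noncomputable def SO10 (F : Type*) [Field F] : Subgroup (Space10 F ≃ₗ[F] Space10 F) :=
  open scoped Classical in
  if ringChar F = 2 then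
    Subgroup.closure {g | ∃ r s, IsReflection10 r ∧ IsReflection10 s ∧ g = r * s}
  else O10 F ⊓ (LinearEquiv.det (R := F) (M := Space10 F)).ker

/-- The proper similitudes of the plus type form in dimension 10, in characteristic different
from 2: the linear maps `g` with `Q(gx) = μ Q(x)` for all `x` and `det g = μ ^ 5`. -/
def GSO10 (F : Type*) [Field F] : Subgroup (Space10 F ≃ₗ[F] Space10 F) where
  carrier := {g | ∃ μ : Fˣ, (∀ x, form10 (g x) = μ * form10 x) ∧ LinearEquiv.det g = μ ^ 5}
  one_mem' := ⟨1, by simp, by simp⟩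
  mul_mem' := by
    rintro g h ⟨μ, hg, hg'⟩ ⟨ν, hh, hh'⟩
    exact ⟨μ * ν, fun x => by rw [LinearEquiv.mul_apply, hg, hh, Units.val_mul, mul_assoc],
      by rw [map_mul, hg', hh', mul_pow]⟩
  inv_mem' := by
    rintro g ⟨μ, hg, hg'⟩
    refine ⟨μ⁻¹, fun x => ?_, by rw [map_inv, hg', inv_pow]⟩
    have h := hg (g⁻¹ x)
    rw [show g (g⁻¹ x) = x from LinearEquiv.apply_symm_apply g x] at h
    rw [h, ← mul_assoc, ← Units.val_mul, inv_mul_cancel, Units.val_one, one_mul]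

/-- The image of the group of proper similitudes in the projective linear group: proper
similitudes modulo nonzero scalars (the centre of the general linear group). -/
def PGSO10 (F : Type*) [Field F] :
    Subgroup ((Space10 F ≃ₗ[F] Space10 F) ⧸ Subgroup.center (Space10 F ≃ₗ[F] Space10 F)) :=
  (GSO10 F).map (QuotientGroup.mk' (Subgroup.center (Space10 F ≃ₗ[F] Space10 F)))

/-! ### Coordinates of the split octonions -/

section SplitOctonions

/-! All white points are equivalent under the group, so the stabilizer may be studied at the vector
W with c = 1 and all other coordinates 0. Write v = (a, b, C) and s = (A, B). Sorted by c, the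
determinant is c·Q(v) plus a form linear in v and quadratic in s (`albertDet_eq`); Q = ab - N(C) is
the plus type form in dimension 10, and polarizing the second part in s gives the pairing of v·s
with t, where v·s is the Clifford action on a 16-dimensional half spin space.

The coefficient of W in det(X + tW) is Q(v), so the stabilizer rescales Q and preserves the
17-dimensional space v = 0, the radical of the pulled back polar form. It therefore acts on the flag
with factors 1, 16, 10: by similitudes on the 10-space (`vecRep`), linearly on the 16-space
(`spinRep`), and compatibly with the Clifford action (`spinPairing_spinRep`). N₂ consists of the
elements that are scalar on the 10-space, and N₁ of those that are moreover trivial on the 16-space.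

(a) An element of N₁ fixes a vector of the 16-space up to a multiple of W. These multiples form a
linear functional, which determines the element by the Clifford relation v·v = Q(v)
(`eq_one_of_act_albertOf16`). (b) On the 16-space N₂ acts by scalars: a map that commutes with the
Clifford action up to a factor amounts to an autotopy of the octonions given by a middle-nuclear
element, and such an element is a scalar (`exists_eq_smul_of_spinPairing`).

(c) S/N₂ acts faithfully on the 10-space modulo scalars, by similitudes that lift to the half spin
space. Reflections generate the orthogonal group (`O10_eq_reflectionGroup10`); products of two
reflections lift, while a single reflection that lifted would force the octonions to commute
(`not_mem_spinLiftable`). Hence isometries that lift are even products of reflections, in every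
characteristic. Dividing a similitude by a standard one that also lifts gives the determinant
condition μ^5; in characteristic 2 the multiplier is removed by a square root. The bound on |S/N₂|
for odd q compares proper similitudes modulo scalars with isometries (`card_PGSO10_le`).

For transitivity, whiteness means that the gradient of det vanishes (`albertSharp`). A solution with
c ≠ 0 is determined by c, A, B and is reached from W by two transvections, up to a scalar; cyclic
permutations and one more transvection produce c ≠ 0. -/

theorem octExt {R : Type*} {x y : SplitOct R} (h : ∀ s, x (s, none) = y (s, none))
    (h0 : ∀ s, x (s, some 0) = y (s, some 0)) (h1 : ∀ s, x (s, some 1) = y (s, some 1))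
    (h2 : ∀ s, x (s, some 2) = y (s, some 2)) : x = y := by
  funext ⟨s, k⟩
  rcases k with _ | k
  · exact h s
  · fin_cases k
    exacts [h0 s, h1 s, h2 s]

variable {R : Type*} [CommRing R]

theorem octMul_true_none (x y : SplitOct R) : octMul x y (true, none) =
    x (true, none) * y (true, none) - x (false, some 0) * y (true, some 0)
      - x (false, some 1) * y (true, some 1) - x (false, some 2) * y (true, some 2) := by
  simp [octMul, octBasisMul, Fintype.sum_prod_type, Fintype.sum_option, Fin.sum_univ_three]
  ring

theorem octMul_true_zero (x y : SplitOct R) : octMul x y (true, some 0) =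
    x (true, some 0) * y (true, none) + x (false, none) * y (true, some 0)
      + x (false, some 1) * y (false, some 2) - x (false, some 2) * y (false, some 1) := by
  simp [octMul, octBasisMul, Fintype.sum_prod_type, Fintype.sum_option, Fin.sum_univ_three]
  ring

theorem octMul_true_one (x y : SplitOct R) : octMul x y (true, some 1) =
    x (true, some 1) * y (true, none) + x (false, none) * y (true, some 1)
      - x (false, some 0) * y (false, some 2) + x (false, some 2) * y (false, some 0) := by
  simp [octMul, octBasisMul, Fintype.sum_prod_type, Fintype.sum_option, Fin.sum_univ_three]
  ring

theorem octMul_true_two (x y : SplitOct R) : octMul x y (true, some 2) =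
    x (true, some 2) * y (true, none) + x (false, none) * y (true, some 2)
      + x (false, some 0) * y (false, some 1) - x (false, some 1) * y (false, some 0) := by
  simp [octMul, octBasisMul, Fintype.sum_prod_type, Fintype.sum_option, Fin.sum_univ_three]
  ring

theorem octMul_false_none (x y : SplitOct R) : octMul x y (false, none) =
    -x (true, some 0) * y (false, some 0) - x (true, some 1) * y (false, some 1)
      - x (true, some 2) * y (false, some 2) + x (false, none) * y (false, none) := by
  simp [octMul, octBasisMul, Fintype.sum_prod_type, Fintype.sum_option, Fin.sum_univ_three]
  ring

theorem octMul_false_zero (x y : SplitOct R) : octMul x y (false, some 0) =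
    x (true, none) * y (false, some 0) + x (true, some 1) * y (true, some 2)
      - x (true, some 2) * y (true, some 1) + x (false, some 0) * y (false, none) := by
  simp [octMul, octBasisMul, Fintype.sum_prod_type, Fintype.sum_option, Fin.sum_univ_three]
  ring

theorem octMul_false_one (x y : SplitOct R) : octMul x y (false, some 1) =
    x (true, none) * y (false, some 1) - x (true, some 0) * y (true, some 2)
      + x (true, some 2) * y (true, some 0) + x (false, some 1) * y (false, none) := by
  simp [octMul, octBasisMul, Fintype.sum_prod_type, Fintype.sum_option, Fin.sum_univ_three]
  ring

theorem octMul_false_two (x y : SplitOct R) : octMul x y (false, some 2) =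
    x (true, none) * y (false, some 2) + x (true, some 0) * y (true, some 1)
      - x (true, some 1) * y (true, some 0) + x (false, some 2) * y (false, none) := by
  simp [octMul, octBasisMul, Fintype.sum_prod_type, Fintype.sum_option, Fin.sum_univ_three]
  ring

attribute [simp] octMul_true_none octMul_true_zero octMul_true_one octMul_true_two
  octMul_false_none octMul_false_zero octMul_false_one octMul_false_two

theorem octNorm_eq (x : SplitOct R) : octNorm x =
    x (true, none) * x (false, none) + x (true, some 0) * x (false, some 0) +
      x (true, some 1) * x (false, some 1) + x (true, some 2) * x (false, some 2) := by
  simp only [octNorm, Fintype.sum_option, Fin.sum_univ_three]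
  ring

/-- The polar form of the octonion norm. -/
def octPolar (x y : SplitOct R) : R :=
  ∑ k : Option (Fin 3), (x (true, k) * y (false, k) + x (false, k) * y (true, k))

theorem octPolar_eq (x y : SplitOct R) : octPolar x y =
    x (true, none) * y (false, none) + x (false, none) * y (true, none) +
      (x (true, some 0) * y (false, some 0) + x (false, some 0) * y (true, some 0)) +
      (x (true, some 1) * y (false, some 1) + x (false, some 1) * y (true, some 1)) +
      (x (true, some 2) * y (false, some 2) + x (false, some 2) * y (true, some 2)) := by
  simp only [octPolar, Fintype.sum_option, Fin.sum_univ_three]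
  ring

@[simp] theorem octConj_none (x : SplitOct R) (s : Bool) : octConj x (s, none) = x (!s, none) := rfl

@[simp] theorem octConj_some (x : SplitOct R) (s : Bool) (k : Fin 3) :
    octConj x (s, some k) = -x (s, some k) := rfl

/-- The octonion multiplication as a bilinear map. -/
def octMulₗ : SplitOct R →ₗ[R] SplitOct R →ₗ[R] SplitOct R :=
  LinearMap.mk₂ R octMul
    (fun x y z => by
      refine octExt ?_ ?_ ?_ ?_ <;> rintro (_ | _) <;> simp <;> ring)
    (fun c x y => by
      refine octExt ?_ ?_ ?_ ?_ <;> rintro (_ | _) <;> simp <;> ring)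
    (fun x y z => by
      refine octExt ?_ ?_ ?_ ?_ <;> rintro (_ | _) <;> simp <;> ring)
    (fun c x y => by
      refine octExt ?_ ?_ ?_ ?_ <;> rintro (_ | _) <;> simp <;> ring)

theorem add_octMul (x y z : SplitOct R) : octMul (x + y) z = octMul x z + octMul y z :=
  LinearMap.map_add₂ octMulₗ x y z

theorem octMul_add (x y z : SplitOct R) : octMul x (y + z) = octMul x y + octMul x z :=
  map_add (octMulₗ x) y z

theorem smul_octMul (c : R) (x y : SplitOct R) : octMul (c • x) y = c • octMul x y :=
  LinearMap.map_smul₂ octMulₗ c x y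

theorem octMul_smul (c : R) (x y : SplitOct R) : octMul x (c • y) = c • octMul x y :=
  map_smul (octMulₗ x) c y

theorem zero_octMul (x : SplitOct R) : octMul 0 x = 0 := LinearMap.map_zero₂ octMulₗ x

theorem octMul_zero (x : SplitOct R) : octMul x 0 = 0 := map_zero (octMulₗ x)

theorem neg_octMul (x y : SplitOct R) : octMul (-x) y = -octMul x y :=
  LinearMap.map_neg₂ octMulₗ x y

theorem octMul_neg (x y : SplitOct R) : octMul x (-y) = -octMul x y := map_neg (octMulₗ x) y

/-- The octonion conjugation as a linear map. -/
def octConjₗ : SplitOct R →ₗ[R] SplitOct R where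
  toFun := octConj
  map_add' x y := by
    refine octExt ?_ ?_ ?_ ?_ <;> rintro (_ | _) <;> simp <;> ring
  map_smul' c x := by
    refine octExt ?_ ?_ ?_ ?_ <;> rintro (_ | _) <;> simp

theorem octConj_add (x y : SplitOct R) : octConj (x + y) = octConj x + octConj y :=
  map_add octConjₗ x y

theorem octConj_smul (c : R) (x : SplitOct R) : octConj (c • x) = c • octConj x :=
  map_smul octConjₗ c x

theorem octConj_neg (x : SplitOct R) : octConj (-x) = -octConj x := map_neg octConjₗ x

theorem octConj_zero : octConj (0 : SplitOct R) = 0 := map_zero octConjₗ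

theorem octConj_octConj (x : SplitOct R) : octConj (octConj x) = x := by
  refine octExt ?_ ?_ ?_ ?_ <;> rintro (_ | _) <;> simp

theorem octConj_octMul (x y : SplitOct R) :
    octConj (octMul x y) = octMul (octConj y) (octConj x) := by
  refine octExt ?_ ?_ ?_ ?_ <;> rintro (_ | _) <;> simp <;> ring

/-- The unit `e₀ + e_{-0}` of the split octonions. -/
def octOne : SplitOct R := fun i => if i.2 = none then 1 else 0

@[simp] theorem octOne_none (s : Bool) : (octOne : SplitOct R) (s, none) = 1 := rfl

@[simp] theorem octOne_some (s : Bool) (k : Fin 3) : (octOne : SplitOct R) (s, some k) = 0 := rfl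

theorem octOne_octMul (x : SplitOct R) : octMul octOne x = x := by
  refine octExt ?_ ?_ ?_ ?_ <;> rintro (_ | _) <;> simp

theorem octMul_octOne (x : SplitOct R) : octMul x octOne = x := by
  refine octExt ?_ ?_ ?_ ?_ <;> rintro (_ | _) <;> simp

/-- This and the next identity are the consequences of alternativity that replace associativity in
the Clifford relation and in the study of isotopies. -/
theorem octConj_octMul_cancel (x y : SplitOct R) :
    octMul (octConj x) (octMul x y) = octNorm x • y := by
  refine octExt ?_ ?_ ?_ ?_ <;> rintro (_ | _) <;> simp [octNorm_eq] <;> ring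

theorem octMul_octConj_cancel (x y : SplitOct R) :
    octMul (octMul y x) (octConj x) = octNorm x • y := by
  refine octExt ?_ ?_ ?_ ?_ <;> rintro (_ | _) <;> simp [octNorm_eq] <;> ring

theorem octNorm_octConj (x : SplitOct R) : octNorm (octConj x) = octNorm x := by
  simp [octNorm_eq]
  ring

theorem octNorm_octMul (x y : SplitOct R) :
    octNorm (octMul x y) = octNorm x * octNorm y := by
  simp [octNorm_eq]
  ring

theorem octNorm_add (x y : SplitOct R) :
    octNorm (x + y) = octNorm x + octNorm y + octPolar x y := by
  simp [octNorm_eq, octPolar_eq]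
  ring

theorem octNorm_smul (c : R) (x : SplitOct R) : octNorm (c • x) = c ^ 2 * octNorm x := by
  simp [octNorm_eq]
  ring

theorem octPolar_comm (x y : SplitOct R) : octPolar x y = octPolar y x := by
  simp [octPolar_eq]
  ring

theorem octPolar_add (x y z : SplitOct R) :
    octPolar x (y + z) = octPolar x y + octPolar x z := by
  simp [octPolar_eq]
  ring

theorem octPolar_smul (c : R) (x y : SplitOct R) : octPolar x (c • y) = c * octPolar x y := by
  simp [octPolar_eq]
  ring

theorem add_octPolar (x y z : SplitOct R) :
    octPolar (x + y) z = octPolar x z + octPolar y z := by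
  rw [octPolar_comm, octPolar_add, octPolar_comm z x, octPolar_comm z y]

theorem smul_octPolar (c : R) (x y : SplitOct R) : octPolar (c • x) y = c * octPolar x y := by
  rw [octPolar_comm, octPolar_smul, octPolar_comm]

theorem octPolar_zero (x : SplitOct R) : octPolar x 0 = 0 := by
  simpa using octPolar_smul (0 : R) x 0

theorem zero_octPolar (x : SplitOct R) : octPolar 0 x = 0 := by
  rw [octPolar_comm, octPolar_zero]

theorem octPolar_single (x : SplitOct R) (s : Bool) (k : Option (Fin 3)) :
    octPolar x (Pi.single (s, k) 1) = x (!s, k) := by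
  rcases s with _ | _ <;> simp [octPolar, Pi.single_apply]

theorem octPolar_nondegenerate {x : SplitOct R} (h : ∀ y, octPolar x y = 0) : x = 0 := by
  funext ⟨s, k⟩
  have := h (Pi.single (!s, k) 1)
  rwa [octPolar_single, Bool.not_not] at this

theorem octPolar_ext {x y : SplitOct R} (h : ∀ z, octPolar x z = octPolar y z) : x = y := by
  have : x + (-1 : R) • y = 0 := octPolar_nondegenerate fun z => by
    rw [add_octPolar, smul_octPolar, h]
    ring
  simpa [← sub_eq_add_neg, sub_eq_zero] using this

/-- The trilinear form `Tr(ABC)` in terms of the polar form. -/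
theorem octTrace_octMul (x y z : SplitOct R) :
    octTrace (octMul (octMul x y) z) = octPolar z (octConj (octMul x y)) := by
  simp [octTrace, octPolar_eq]
  ring

/-- The trace of a triple product is cyclic although the product is not associative; this is what
makes the cyclic permutation of A, B, C an isometry of the determinant. -/
theorem octTrace_octMul_cycle (x y z : SplitOct R) :
    octTrace (octMul (octMul x y) z) = octTrace (octMul (octMul y z) x) := by
  simp [octTrace]
  ring

/-- An element that associates in the middle of all products is a scalar. -/
theorem eq_smul_octOne_of_middle {p : SplitOct R}
    (h : ∀ x y, octMul (octMul x p) y = octMul x (octMul p y)) :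
    p = p (true, none) • octOne := by
  have h' (i j k : OctIdx) := congrFun (h (Pi.single i 1) (Pi.single j 1)) k
  -- Seven test triples are enough: each of the first six kills one coordinate off the diagonal, and
  -- `d` equates the coefficients of e₀ and e_{-0}.
  have t2 := h' (true, none) (true, some 0) (false, some 1)
  have t1 := h' (true, none) (true, some 0) (false, some 2)
  have t0 := h' (true, none) (true, some 1) (false, some 2)
  have f2 := h' (true, none) (false, some 0) (true, some 1)
  have f1 := h' (true, none) (false, some 0) (true, some 2)
  have f0 := h' (true, none) (false, some 1) (true, some 2)
  have d := h' (true, some 0) (true, some 1) (false, some 2)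
  simp at t0 t1 t2 f0 f1 f2 d
  refine octExt ?_ ?_ ?_ ?_ <;> rintro (_ | _) <;> simp [t0.symm, t1, t2.symm, f0, f1, f2, d]

theorem not_octMul_comm [Nontrivial R] : ¬ ∀ x y : SplitOct R, octMul x y = octMul y x := by
  intro h
  have h0 := congrFun (h (Pi.single (true, none) 1) (Pi.single (true, some 0) 1)) (true, some 0)
  simp at h0

end SplitOctonions

/-! ### The Clifford action on half spin spaces -/

section HalfSpin

variable {F : Type*} [Field F]

/-- The position of the hyperbolic plane of `Space10 F` that corresponds to the octonion
coordinates `e_k` and `e_{-k}`. -/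
def octPlane : Option (Fin 3) → Fin 5
  | none => 1
  | some k => k.succ.succ

/-- The octonion part of a vector of `Space10 F`. -/
def space10Oct : Space10 F →ₗ[F] SplitOct F where
  toFun v i := if i.1 then v (octPlane i.2, true) else -v (octPlane i.2, false)
  map_add' v w := by
    funext i
    by_cases h : i.1 <;> simp [h, add_comm]
  map_smul' c v := by
    funext i
    by_cases h : i.1 <;> simp [h]

theorem form10_eq (v : Space10 F) :
    form10 v = v (0, true) * v (0, false) - octNorm (space10Oct v) := by
  simp [form10, Fin.sum_univ_succ, octNorm_eq, space10Oct, octPlane]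
  ring

/-- The vector of `Space10 F` with given coordinates `a`, `b` and octonion part. -/
def space10Mk (a b : F) (C : SplitOct F) : Space10 F := fun i =>
  ![if i.2 then a else b, if i.2 then C (true, none) else -C (false, none),
    if i.2 then C (true, some 0) else -C (false, some 0),
    if i.2 then C (true, some 1) else -C (false, some 1),
    if i.2 then C (true, some 2) else -C (false, some 2)] i.1

@[simp] theorem space10Mk_true (a b : F) (C : SplitOct F) : space10Mk a b C (0, true) = a := rfl

@[simp] theorem space10Mk_false (a b : F) (C : SplitOct F) : space10Mk a b C (0, false) = b := rfl

@[simp] theorem space10Oct_space10Mk (a b : F) (C : SplitOct F) :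
    space10Oct (space10Mk a b C) = C := by
  refine octExt ?_ ?_ ?_ ?_ <;> rintro (_ | _) <;> simp [space10Oct, octPlane, space10Mk]

theorem space10Mk_eq (v : Space10 F) :
    space10Mk (v (0, true)) (v (0, false)) (space10Oct v) = v := by
  funext ⟨i, s⟩
  fin_cases i <;> rcases s with _ | _ <;> simp [space10Mk, space10Oct, octPlane]

/-- The 16-dimensional half spin space, as pairs of octonions. -/
abbrev HalfSpin (F : Type*) : Type _ := SplitOct F × SplitOct F

/-- The Clifford action of a vector of `Space10 F`, from one half spin space to the other. -/
def clifford : Space10 F →ₗ[F] HalfSpin F →ₗ[F] HalfSpin F :=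
  LinearMap.mk₂ F
    (fun v s => (octConj (octMul s.2 (space10Oct v)) - v (0, true) • s.1,
      octConj (octMul (space10Oct v) s.1) - v (0, false) • s.2))
    (fun v w s => by
      ext1
      · simp only [map_add, octMul_add, octConj_add, Pi.add_apply, add_smul, Prod.fst_add]; abel
      · simp only [map_add, add_octMul, octConj_add, Pi.add_apply, add_smul, Prod.snd_add]; abel)
    (fun c v s => by
      ext1
      · simp only [map_smul, octMul_smul, octConj_smul, Pi.smul_apply, smul_eq_mul, mul_smul,
          Prod.smul_fst, smul_sub]
      · simp only [map_smul, smul_octMul, octConj_smul, Pi.smul_apply, smul_eq_mul, mul_smul,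
          Prod.smul_snd, smul_sub])
    (fun v s t => by
      ext1
      · simp only [Prod.snd_add, Prod.fst_add, add_octMul, octConj_add, smul_add]; abel
      · simp only [Prod.snd_add, Prod.fst_add, octMul_add, octConj_add, smul_add]; abel)
    (fun c v s => by
      ext1
      · simp only [Prod.smul_fst, Prod.smul_snd, smul_octMul, octConj_smul, smul_sub,
          smul_comm c (v (0, true))]
      · simp only [Prod.smul_fst, Prod.smul_snd, octMul_smul, octConj_smul, smul_sub,
          smul_comm c (v (0, false))])

theorem clifford_fst (v : Space10 F) (s : HalfSpin F) : (clifford v s).1 =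
    octConj (octMul s.2 (space10Oct v)) - v (0, true) • s.1 := rfl

theorem clifford_snd (v : Space10 F) (s : HalfSpin F) : (clifford v s).2 =
    octConj (octMul (space10Oct v) s.1) - v (0, false) • s.2 := rfl

/-- The isometry that identifies the Clifford actions on the two half spin spaces. -/
def spinFlip : Space10 F →ₗ[F] Space10 F where
  toFun v := space10Mk (v (0, false)) (v (0, true)) (-space10Oct v)
  map_add' v w := by
    funext ⟨i, s⟩
    fin_cases i <;> rcases s with _ | _ <;> simp [space10Mk, add_comm]
  map_smul' c v := by
    funext ⟨i, s⟩
    fin_cases i <;> rcases s with _ | _ <;> simp [space10Mk]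

@[simp] theorem spinFlip_true (v : Space10 F) : spinFlip v (0, true) = v (0, false) := rfl

@[simp] theorem spinFlip_false (v : Space10 F) : spinFlip v (0, false) = v (0, true) := rfl

@[simp] theorem space10Oct_spinFlip (v : Space10 F) :
    space10Oct (spinFlip v) = -space10Oct v :=
  space10Oct_space10Mk _ _ _

theorem spinFlip_spinFlip (v : Space10 F) : spinFlip (spinFlip v) = v := by
  rw [← space10Mk_eq (spinFlip (spinFlip v))]
  simp [space10Mk_eq]

theorem form10_spinFlip (v : Space10 F) : form10 (spinFlip v) = form10 v := by
  simp only [form10_eq, spinFlip_true, spinFlip_false, space10Oct_spinFlip]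
  rw [show -space10Oct v = (-1 : F) • space10Oct v by simp, octNorm_smul]
  ring

theorem polar_form10_spinFlip (v w : Space10 F) :
    QuadraticMap.polar form10 (spinFlip v) (spinFlip w) = QuadraticMap.polar form10 v w := by
  simp only [QuadraticMap.polar, ← map_add, form10_spinFlip]

/-- The Clifford relation v·v = Q(v). A vector maps one half spin space to the other; both are
modelled on the same pairs of octonions, so the second factor must be precomposed with `spinFlip`.
Only the cancellation laws for x̄(xy) and (yx)x̄ enter. -/
theorem clifford_spinFlip_clifford (v : Space10 F) (s : HalfSpin F) :
    clifford (spinFlip v) (clifford v s) = form10 v • s := by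
  have h1 (x y : SplitOct F) : octMul (octConj (octMul x y)) x = octNorm x • octConj y := by
    rw [octConj_octMul, ← octNorm_octConj x]
    simpa [octConj_octConj] using octMul_octConj_cancel (octConj x) (octConj y)
  have h2 (x y : SplitOct F) : octMul x (octConj (octMul y x)) = octNorm x • octConj y := by
    rw [octConj_octMul, ← octNorm_octConj x]
    simpa [octConj_octConj] using octConj_octMul_cancel (octConj x) (octConj y)
  have h3 (x y : SplitOct F) (c : F) : octMul (octConj x - c • y) (-space10Oct v) =
      -octMul (octConj x) (space10Oct v) + c • octMul y (space10Oct v) := by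
    rw [octMul_neg, sub_eq_add_neg, add_octMul, ← neg_smul, smul_octMul, neg_smul]
    abel
  have h4 (x y : SplitOct F) (c : F) : octMul (-space10Oct v) (octConj x - c • y) =
      -octMul (space10Oct v) (octConj x) + c • octMul (space10Oct v) y := by
    rw [neg_octMul, sub_eq_add_neg, octMul_add, ← neg_smul, octMul_smul, neg_smul]
    abel
  ext1
  · rw [clifford_fst, clifford_snd, clifford_fst, space10Oct_spinFlip, spinFlip_true, h3, h1,
      octConj_add, octConj_neg, octConj_smul, octConj_smul, octConj_octConj, form10_eq,
      Prod.smul_fst]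
    module
  · rw [clifford_snd, clifford_fst, clifford_snd, space10Oct_spinFlip, spinFlip_false, h4, h2,
      octConj_add, octConj_neg, octConj_smul, octConj_smul, octConj_octConj, form10_eq,
      Prod.smul_snd]
    module

/-- The pairing of the two half spin spaces. -/
def spinPairing (s t : HalfSpin F) : F := octPolar s.1 t.1 + octPolar s.2 t.2

theorem spinPairing_comm (s t : HalfSpin F) : spinPairing s t = spinPairing t s := by
  rw [spinPairing, octPolar_comm, octPolar_comm s.2, spinPairing]

theorem spinPairing_smul (c : F) (s t : HalfSpin F) :
    spinPairing s (c • t) = c * spinPairing s t := by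
  simp only [spinPairing, Prod.smul_fst, Prod.smul_snd, octPolar_smul]
  ring

theorem smul_spinPairing (c : F) (s t : HalfSpin F) :
    spinPairing (c • s) t = c * spinPairing s t := by
  rw [spinPairing_comm, spinPairing_smul, spinPairing_comm]

theorem spinPairing_nondegenerate {s : HalfSpin F} (h : ∀ t, spinPairing s t = 0) : s = 0 := by
  ext1
  · exact octPolar_nondegenerate fun y => by simpa [spinPairing, octPolar_zero] using h (y, 0)
  · exact octPolar_nondegenerate fun y => by simpa [spinPairing, octPolar_zero] using h (0, y)

/-- The right side is the polarization in (A, B) of the mixed part of the determinant; this links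
the cubic form to the Clifford action. -/
theorem spinPairing_clifford (v : Space10 F) (s t : HalfSpin F) :
    spinPairing (clifford v s) t = -(v (0, true) * octPolar s.1 t.1)
      - v (0, false) * octPolar s.2 t.2
      + octTrace (octMul (octMul t.1 s.2) (space10Oct v))
      + octTrace (octMul (octMul s.1 t.2) (space10Oct v)) := by
  have h1 : octTrace (octMul (octMul t.1 s.2) (space10Oct v)) =
      octPolar (octConj (octMul s.2 (space10Oct v))) t.1 := by
    rw [octTrace_octMul_cycle, octTrace_octMul, octPolar_comm]
  have h2 : octTrace (octMul (octMul s.1 t.2) (space10Oct v)) =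
      octPolar (octConj (octMul (space10Oct v) s.1)) t.2 := by
    rw [octTrace_octMul_cycle, octTrace_octMul_cycle, octTrace_octMul, octPolar_comm]
  rw [h1, h2, spinPairing, clifford_fst, clifford_snd, sub_eq_add_neg, sub_eq_add_neg,
    ← neg_smul, ← neg_smul, add_octPolar, add_octPolar, smul_octPolar, smul_octPolar]
  ring

theorem spinPairing_clifford_comm (v : Space10 F) (s t : HalfSpin F) :
    spinPairing (clifford v s) t = spinPairing s (clifford v t) := by
  rw [spinPairing_comm s, spinPairing_clifford, spinPairing_clifford, octPolar_comm s.1,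
    octPolar_comm s.2]
  ring

theorem clifford_clifford_spinFlip (v : Space10 F) (s : HalfSpin F) :
    clifford v (clifford (spinFlip v) s) = form10 v • s := by
  have h := clifford_spinFlip_clifford (spinFlip v) s
  rwa [spinFlip_spinFlip, form10_spinFlip] at h

theorem clifford_add_clifford (u v : Space10 F) (s : HalfSpin F) :
    clifford (spinFlip v) (clifford u s) + clifford (spinFlip u) (clifford v s) =
      QuadraticMap.polar form10 v u • s := by
  have h := clifford_spinFlip_clifford (v + u) s
  simp only [map_add, LinearMap.add_apply, clifford_spinFlip_clifford] at h
  rw [QuadraticMap.polar, sub_smul, sub_smul, ← h]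
  abel

/-- The reflection of a vector in the form of `IsReflection10`. -/
theorem clifford_reflection (u v : Space10 F) (hu : form10 u ≠ 0) (s : HalfSpin F) :
    clifford (v - (QuadraticMap.polar form10 v u / form10 u) • u) s =
      -(form10 u)⁻¹ • clifford u (clifford (spinFlip v) (clifford u s)) := by
  have h := congrArg (clifford u) (clifford_add_clifford u v s)
  rw [map_add, map_smul, clifford_clifford_spinFlip] at h
  rw [map_sub, map_smul, LinearMap.sub_apply, LinearMap.smul_apply, eq_sub_of_add_eq h, smul_sub,
    smul_smul, smul_smul, neg_mul, neg_mul, inv_mul_cancel₀ hu, div_eq_inv_mul]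
  module

/-- The similitudes of the vector representation that lift to the half spin space, up to
scalars. -/
def spinLiftable (F : Type*) [Field F] : Subgroup (Space10 F ≃ₗ[F] Space10 F) where
  carrier := {g | ∃ (h : HalfSpin F ≃ₗ[F] HalfSpin F) (c : Fˣ), ∀ v s t,
    spinPairing (clifford (g v) (h s)) (h t) = c * spinPairing (clifford v s) t}
  one_mem' := ⟨1, 1, fun v s t => by simp⟩
  mul_mem' := by
    rintro g g' ⟨h, c, hg⟩ ⟨h', c', hg'⟩
    refine ⟨h * h', c * c', fun v s t => ?_⟩
    rw [LinearEquiv.mul_apply, LinearEquiv.mul_apply, LinearEquiv.mul_apply, hg, hg',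
      Units.val_mul, mul_assoc]
  inv_mem' := by
    rintro g ⟨h, c, hg⟩
    refine ⟨h⁻¹, c⁻¹, fun v s t => ?_⟩
    have := hg (g⁻¹ v) (h⁻¹ s) (h⁻¹ t)
    rw [show g (g⁻¹ v) = v from LinearEquiv.apply_symm_apply g v,
      show h (h⁻¹ s) = s from LinearEquiv.apply_symm_apply h s,
      show h (h⁻¹ t) = t from LinearEquiv.apply_symm_apply h t] at this
    rw [this, ← mul_assoc, ← Units.val_mul, inv_mul_cancel, Units.val_one, one_mul]

theorem mem_spinLiftable_iff {g : Space10 F ≃ₗ[F] Space10 F} :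
    g ∈ spinLiftable F ↔ ∃ (h : HalfSpin F ≃ₗ[F] HalfSpin F) (c : Fˣ), ∀ v s t,
      spinPairing (clifford (g v) (h s)) (h t) = c * spinPairing (clifford v s) t :=
  Iff.rfl

theorem spinFlip_reflection (u v : Space10 F) :
    spinFlip (v - (QuadraticMap.polar form10 v u / form10 u) • u) =
      spinFlip v - (QuadraticMap.polar form10 (spinFlip v) (spinFlip u) /
        form10 (spinFlip u)) • spinFlip u := by
  rw [map_sub, map_smul, polar_form10_spinFlip, form10_spinFlip]

/-- A reflected vector acts as a multiple of u·v·u. Doing this twice and moving the outer factors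
across the pairing by self-adjointness leaves v between two copies of the operator (flip of w)·u.
One reflection alone changes the half spin space, which is why reflections are taken in pairs. -/
theorem IsReflection10.mul_mem_spinLiftable {r r' : Space10 F ≃ₗ[F] Space10 F}
    (hr : IsReflection10 r) (hr' : IsReflection10 r') : r * r' ∈ spinLiftable F := by
  obtain ⟨u, hu, hr⟩ := hr
  obtain ⟨w, hw, hr'⟩ := hr'
  have key (v s t) : spinPairing (clifford (r (r' v)) s) t = (form10 u * form10 w)⁻¹ *
      spinPairing (clifford v (clifford (spinFlip w) (clifford u s)))
        (clifford (spinFlip w) (clifford u t)) := by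
    rw [hr, clifford_reflection u _ hu, hr', spinFlip_reflection, clifford_reflection,
      form10_spinFlip, spinFlip_spinFlip, map_smul, smul_smul, smul_spinPairing,
      spinPairing_clifford_comm, spinPairing_clifford_comm, mul_inv, neg_mul_neg]
    rwa [form10_spinFlip]
  have h1 (s : HalfSpin F) : clifford (spinFlip u) (clifford w
      (clifford (spinFlip w) (clifford u s))) = (form10 u * form10 w) • s := by
    rw [clifford_clifford_spinFlip, map_smul, clifford_spinFlip_clifford, smul_smul, mul_comm]
  have h2 (s : HalfSpin F) : clifford (spinFlip w) (clifford u
      (clifford (spinFlip u) (clifford w s))) = (form10 u * form10 w) • s := by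
    rw [clifford_clifford_spinFlip, map_smul, clifford_spinFlip_clifford, smul_smul]
  have h0 : form10 u * form10 w ≠ 0 := mul_ne_zero hu hw
  let h : HalfSpin F ≃ₗ[F] HalfSpin F := LinearEquiv.ofLinearMap
    (clifford (spinFlip w) ∘ₗ clifford u)
    ((form10 u * form10 w)⁻¹ • (clifford (spinFlip u) ∘ₗ clifford w))
    (LinearMap.ext fun s => by
      simp only [LinearMap.comp_apply, LinearMap.smul_apply, map_smul, h2, smul_smul,
        LinearMap.id_apply, inv_mul_cancel₀ h0, one_smul])
    (LinearMap.ext fun s => by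
      simp only [LinearMap.comp_apply, LinearMap.smul_apply, h1, smul_smul,
        LinearMap.id_apply, inv_mul_cancel₀ h0, one_smul])
  -- In `key` the operator stands on the side of v and not of r r' v, so it lifts the inverse of r
  -- r'.
  refine inv_mem_iff.mp (mem_spinLiftable_iff.mpr ⟨h, Units.mk0 _ h0, fun v s t => ?_⟩)
  have e := key ((r * r')⁻¹ v) s t
  rw [show r (r' ((r * r')⁻¹ v)) = v from LinearEquiv.apply_symm_apply (r * r') v] at e
  rw [e, Units.val_mk0, ← mul_assoc, mul_inv_cancel₀ h0, one_mul]
  rfl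

end HalfSpin

/-! ### Rigidity of the Clifford action: octonion isotopies and the non-lifting of a swap -/

section Rigidity

variable {F : Type*} [Field F]

theorem octTrace_zero : octTrace (0 : SplitOct F) = 0 := by
  simp [octTrace]

theorem octTrace_smul (c : F) (x : SplitOct F) : octTrace (c • x) = c * octTrace x := by
  simp [octTrace, mul_add]

theorem octTrace_nondegenerate {x y : SplitOct F}
    (h : ∀ z, octTrace (octMul x z) = octTrace (octMul y z)) : x = y := by
  have e (x z : SplitOct F) : octTrace (octMul x (octConj z)) = octPolar x z := by
    simp [octTrace, octPolar_eq]
    ring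
  exact octPolar_ext fun z => by rw [← e, ← e, h]

/-- Commuting with e₀ removes all coordinates off the diagonal, and commuting with e₁ equates the
two that remain. -/
theorem eq_smul_octOne_of_comm {p : SplitOct F} (h : ∀ x, octMul x p = octMul p x) :
    p = p (true, none) • octOne := by
  have h' (i k : OctIdx) := congrFun (h (Pi.single i 1)) k
  have t2 := h' (true, none) (true, some 2)
  have t1 := h' (true, none) (true, some 1)
  have t0 := h' (true, none) (true, some 0)
  have f2 := h' (true, none) (false, some 2)
  have f1 := h' (true, none) (false, some 1)
  have f0 := h' (true, none) (false, some 0)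
  have d := h' (true, some 0) (true, some 0)
  simp at t0 t1 t2 f0 f1 f2 d
  refine octExt ?_ ?_ ?_ ?_ <;> rintro (_ | _) <;>
    simp [t0.symm, t1.symm, t2.symm, f0, f1, f2, d]

theorem octOne_smul_octMul (c : F) (x : SplitOct F) : octMul (c • octOne) x = c • x := by
  rw [smul_octMul, octOne_octMul]

theorem octMul_smul_octOne (c : F) (x : SplitOct F) : octMul x (c • octOne) = c • x := by
  rw [octMul_smul, octMul_octOne]

theorem octNorm_octOne : octNorm (octOne : SplitOct F) = 1 := by
  simp [octNorm_eq]

/-- Isotopies from a unital product to the octonion product are given by a pair of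
multiplications. -/
theorem exists_octMul_of_isotopy {f₁ f₂ : SplitOct F → SplitOct F} {c : F} (hc : c ≠ 0)
    (m : SplitOct F → SplitOct F → SplitOct F) (hm : ∀ x, m x octOne = x)
    (hm' : ∀ x, m octOne x = x) (h : ∀ x y, octMul (f₁ x) (f₂ y) = c • m x y) :
    ∃ p, octNorm p ≠ 0 ∧ (∀ x, f₁ x = octMul x p) ∧
      (∀ y, f₂ y = (c / octNorm p) • octMul (octConj p) y) ∧
      ∀ x y, octMul (octMul x p) y = m x (octMul p y) := by
  -- The images p and s of the unit satisfy ps = c·1, so both norms are nonzero; multiplying by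
  -- conjugates then recovers both maps from p.
  set p := f₁ octOne with hp
  set s := f₂ octOne with hs
  have hps : octMul p s = c • octOne := by rw [h, hm]
  have hN : octNorm p * octNorm s = c ^ 2 := by
    rw [← octNorm_octMul, hps, octNorm_smul, octNorm_octOne, mul_one]
  have hpN : octNorm p ≠ 0 := left_ne_zero_of_mul (hN ▸ pow_ne_zero 2 hc)
  have hsN : octNorm s ≠ 0 := right_ne_zero_of_mul (hN ▸ pow_ne_zero 2 hc)
  have e2 (y : SplitOct F) : f₂ y = (c / octNorm p) • octMul (octConj p) y := by
    have := congrArg (octMul (octConj p)) (h octOne y)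
    rw [← hp, octConj_octMul_cancel, hm', octMul_smul] at this
    rw [div_eq_inv_mul, mul_smul, ← this, smul_smul, inv_mul_cancel₀ hpN, one_smul]
  have e1 (x : SplitOct F) : f₁ x = octMul x p := by
    have h1 : octNorm s • p = c • octConj s := by
      rw [← octMul_octConj_cancel, hps, octOne_smul_octMul]
    have := congrArg (fun z => octMul z (octConj s)) (h x octOne)
    simp only [← hs, octMul_octConj_cancel, hm, smul_octMul] at this
    rw [← octMul_smul, ← h1, octMul_smul] at this
    exact smul_right_injective _ hsN this
  refine ⟨p, hpN, e1, e2, fun x y => ?_⟩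
  have := h x (octMul p y)
  rw [e1, e2, octConj_octMul_cancel, smul_smul, div_mul_cancel₀ _ hpN, octMul_smul] at this
  exact smul_right_injective _ hc this

theorem spinPairing_clifford_inl (s t : HalfSpin F) :
    spinPairing (clifford (space10Mk 1 0 0) s) t = -octPolar s.1 t.1 := by
  simp [spinPairing_clifford, octTrace]

theorem spinPairing_clifford_inr (s t : HalfSpin F) :
    spinPairing (clifford (space10Mk 0 1 0) s) t = -octPolar s.2 t.2 := by
  simp [spinPairing_clifford, octTrace]

theorem spinPairing_clifford_oct (C : SplitOct F) (s t : HalfSpin F) :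
    spinPairing (clifford (space10Mk 0 0 C) s) t =
      octTrace (octMul (octMul t.1 s.2) C) + octTrace (octMul (octMul s.1 t.2) C) := by
  simp [spinPairing_clifford]

/-- A linear automorphism of the half spin space that commutes with the Clifford action up to a
scalar is itself a scalar. -/
theorem exists_eq_smul_of_spinPairing {h : HalfSpin F ≃ₗ[F] HalfSpin F} {c : F} (hc : c ≠ 0)
    (H : ∀ v s t, spinPairing (clifford v (h s)) (h t) = c * spinPairing (clifford v s) t) :
    ∃ μ : F, μ ^ 2 = c ∧ ∀ s, h s = μ • s := by
  have ha (s t) : octPolar (h s).1 (h t).1 = c * octPolar s.1 t.1 := by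
    simpa [spinPairing_clifford_inl] using H (space10Mk 1 0 0) s t
  have hb (s t) : octPolar (h s).2 (h t).2 = c * octPolar s.2 t.2 := by
    simpa [spinPairing_clifford_inr] using H (space10Mk 0 1 0) s t
  -- Since h is surjective, `ha` puts the first component of h(0, B) into the radical of the norm
  -- form. Hence h is block diagonal, and its two blocks form an isotopy of the octonions.
  have h12 (B) : (h (0, B)).1 = 0 := octPolar_nondegenerate fun z => by
    simpa [zero_octPolar] using ha (0, B) (h.symm (z, 0))
  have h21 (A) : (h (A, 0)).2 = 0 := octPolar_nondegenerate fun z => by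
    simpa [zero_octPolar] using hb (A, 0) (h.symm (0, z))
  have hm (A B) : octMul (h (A, 0)).1 (h (0, B)).2 = c • octMul A B :=
    octTrace_nondegenerate fun C => by
      have := H (space10Mk 0 0 C) (A, 0) (0, B)
      rw [spinPairing_clifford_oct, spinPairing_clifford_oct, h12, h21] at this
      simp only [octMul_zero, zero_octMul, octTrace_zero, zero_add] at this
      rw [this, smul_octMul, octTrace_smul]
  obtain ⟨p, hpN, e1, e2, e3⟩ := exists_octMul_of_isotopy (f₁ := fun A => (h (A, 0)).1)
    (f₂ := fun B => (h (0, B)).2) hc octMul octMul_octOne octOne_octMul hm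
  have hp := eq_smul_octOne_of_middle e3
  set μ := p (true, none)
  have hN : octNorm p = μ ^ 2 := by rw [hp, octNorm_smul, octNorm_octOne, mul_one]
  have hμ : μ ≠ 0 := fun h0 => hpN (by rw [hN, h0]; simp)
  have hcμ : μ ^ 2 = c := by
    have := ha (Pi.single (true, none) 1, 0) (Pi.single (false, none) 1, 0)
    simp only [e1, hp, octMul_smul_octOne, octPolar_smul, octPolar_single] at this
    simpa [sq] using this
  refine ⟨μ, hcμ, fun s => ?_⟩
  have hs : s = (s.1, 0) + (0, s.2) := by simp
  have hc1 : octConj (octOne : SplitOct F) = octOne := by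
    refine octExt ?_ ?_ ?_ ?_ <;> rintro (_ | _) <;> simp
  rw [hs, map_add]
  ext1
  · simp only [Prod.fst_add, h12, e1, Prod.smul_fst]
    rw [hp, octMul_smul_octOne]
    simp
  · simp only [Prod.snd_add, h21, e2, Prod.smul_snd]
    rw [hN, hp, octConj_smul, hc1, octOne_smul_octMul, hcμ, div_self hc]
    simp

/-- A map that swaps the first two coordinates does not lift to the half spin space. -/
theorem not_mem_spinLiftable {r : Space10 F ≃ₗ[F] Space10 F}
    (hr : ∀ a b C, r (space10Mk a b C) = space10Mk b a C) : r ∉ spinLiftable F := by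
  rintro ⟨h, c, H⟩
  have hc := c.ne_zero
  have ha (s t) : octPolar (h s).2 (h t).2 = c * octPolar s.1 t.1 := by
    simpa [spinPairing_clifford_inl, spinPairing_clifford_inr, hr] using H (space10Mk 1 0 0) s t
  have hb (s t) : octPolar (h s).1 (h t).1 = c * octPolar s.2 t.2 := by
    simpa [spinPairing_clifford_inl, spinPairing_clifford_inr, hr] using H (space10Mk 0 1 0) s t
  have h22 (B) : (h (0, B)).2 = 0 := octPolar_nondegenerate fun z => by
    simpa [zero_octPolar] using ha (0, B) (h.symm (0, z))
  have h11 (A) : (h (A, 0)).1 = 0 := octPolar_nondegenerate fun z => by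
    simpa [zero_octPolar] using hb (A, 0) (h.symm (z, 0))
  -- The blocks now change places, so the isotopy relates the product to the opposite product. Its
  -- parameter p commutes with everything, hence is a scalar, and cancelling it makes the octonions
  -- commutative.
  have hm (B A) : octMul (h (0, B)).1 (h (A, 0)).2 = (c : F) • octMul A B :=
    octTrace_nondegenerate fun C => by
      have := H (space10Mk 0 0 C) (A, 0) (0, B)
      rw [hr, spinPairing_clifford_oct, spinPairing_clifford_oct, h11, h22] at this
      simp only [octMul_zero, zero_octMul, octTrace_zero, zero_add, add_zero] at this
      rw [this, smul_octMul, octTrace_smul]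
  obtain ⟨p, hpN, -, -, e3⟩ := exists_octMul_of_isotopy (f₁ := fun B => (h (0, B)).1)
    (f₂ := fun A => (h (A, 0)).2) hc (fun B A => octMul A B) octOne_octMul octMul_octOne hm
  have hp := eq_smul_octOne_of_comm fun x => by simpa [octMul_octOne] using e3 x octOne
  have hμ : p (true, none) ≠ 0 := fun h0 => hpN (by rw [hp, h0, octNorm_smul]; simp)
  refine not_octMul_comm (R := F) fun x y => smul_right_injective _ hμ ?_
  have := e3 x y
  rw [hp, octMul_smul_octOne, octOne_smul_octMul, smul_octMul, smul_octMul] at this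
  exact this

end Rigidity

/-! ### Generation of the orthogonal group by reflections -/

section Orthogonal

variable {F : Type*} [Field F]

/-- The polar form of `form10` as a bilinear map. -/
def bil10 : Space10 F →ₗ[F] Space10 F →ₗ[F] F :=
  LinearMap.mk₂ F (fun x y => ∑ i, (x (i, true) * y (i, false) + x (i, false) * y (i, true)))
    (fun x y z => by
      rw [← Finset.sum_add_distrib]
      exact Finset.sum_congr rfl fun i _ => by simp only [Pi.add_apply]; ring)
    (fun c x y => by
      rw [smul_eq_mul, Finset.mul_sum]
      exact Finset.sum_congr rfl fun i _ => by simp only [Pi.smul_apply, smul_eq_mul]; ring)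
    (fun x y z => by
      rw [← Finset.sum_add_distrib]
      exact Finset.sum_congr rfl fun i _ => by simp only [Pi.add_apply]; ring)
    (fun c x y => by
      rw [smul_eq_mul, Finset.mul_sum]
      exact Finset.sum_congr rfl fun i _ => by simp only [Pi.smul_apply, smul_eq_mul]; ring)

theorem bil10_apply (x y : Space10 F) :
    bil10 x y = ∑ i, (x (i, true) * y (i, false) + x (i, false) * y (i, true)) := rfl

theorem form10_add (x y : Space10 F) : form10 (x + y) = form10 x + form10 y + bil10 x y := by
  simp only [form10, bil10_apply, ← Finset.sum_add_distrib]
  exact Finset.sum_congr rfl fun i _ => by simp only [Pi.add_apply]; ring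

theorem form10_smul (c : F) (x : Space10 F) : form10 (c • x) = c ^ 2 * form10 x := by
  simp only [form10, Finset.mul_sum]
  exact Finset.sum_congr rfl fun i _ => by simp only [Pi.smul_apply, smul_eq_mul]; ring

theorem form10_neg (x : Space10 F) : form10 (-x) = form10 x := by
  simp [form10]

theorem polar_form10 (x y : Space10 F) : QuadraticMap.polar form10 x y = bil10 x y := by
  rw [QuadraticMap.polar, form10_add]
  ring

theorem bil10_comm (x y : Space10 F) : bil10 x y = bil10 y x := by
  rw [← polar_form10, QuadraticMap.polar_comm, polar_form10]

theorem bil10_self (x : Space10 F) : bil10 x x = 2 * form10 x := by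
  have := form10_add x x
  rw [show x + x = (2 : F) • x by module, form10_smul] at this
  linear_combination -this

theorem form10_sub (x y : Space10 F) : form10 (x - y) = form10 x + form10 y - bil10 x y := by
  rw [sub_eq_add_neg, form10_add, form10_neg, map_neg, sub_eq_add_neg]

theorem bil10_single (x : Space10 F) (i : Fin 5) (s : Bool) :
    bil10 x (Pi.single (i, s) 1) = x (i, !s) := by
  rcases s with _ | _ <;> simp [bil10_apply, Pi.single_apply]

theorem form10_single (i : Fin 5) (s : Bool) :
    form10 (Pi.single (i, s) 1 : Space10 F) = 0 := by
  rcases s with _ | _ <;> simp [form10, Pi.single_apply]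

theorem bil10_map {g : Space10 F ≃ₗ[F] Space10 F} (hg : g ∈ O10 F) (x y : Space10 F) :
    bil10 (g x) (g y) = bil10 x y := by
  have h : ∀ z, form10 (g z) = form10 z := hg
  rw [← polar_form10, ← polar_form10, QuadraticMap.polar, ← map_add, h, h, h, QuadraticMap.polar]

/-- The reflection in `u`; it is the identity if `u` is singular. -/
def reflection10 (u : Space10 F) : Space10 F ≃ₗ[F] Space10 F :=
  LinearEquiv.ofInvolutive (LinearMap.id - ((form10 u)⁻¹ • bil10.flip u).smulRight u) fun x => by
    by_cases h : form10 u = 0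
    · simp [h]
    · simp only [LinearMap.sub_apply, LinearMap.id_apply, LinearMap.smulRight_apply,
        LinearMap.smul_apply, LinearMap.flip_apply, map_sub, map_smul, bil10_self, smul_eq_mul]
      rw [show (form10 u)⁻¹ * (2 * form10 u) = 2 by field_simp]
      module

theorem reflection10_apply (u x : Space10 F) :
    reflection10 u x = x - (bil10 x u / form10 u) • u := by
  rw [div_eq_inv_mul]
  rfl

theorem isReflection10_iff {r : Space10 F ≃ₗ[F] Space10 F} :
    IsReflection10 r ↔ ∃ u, form10 u ≠ 0 ∧ r = reflection10 u := by
  simp only [IsReflection10, LinearEquiv.ext_iff, reflection10_apply, polar_form10]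

theorem reflection10_mul_self (u : Space10 F) : reflection10 u * reflection10 u = 1 :=
  LinearEquiv.ext fun x => (reflection10 u).symm_apply_apply x

theorem reflection10_mem_O10 (u : Space10 F) : reflection10 u ∈ O10 F := by
  intro x
  rw [reflection10_apply, form10_sub, form10_smul, map_smul, smul_eq_mul]
  by_cases h : form10 u = 0
  · simp [h]
  · field_simp
    ring

/-- The group generated by all reflections. -/
def reflectionGroup10 (F : Type*) [Field F] : Subgroup (Space10 F ≃ₗ[F] Space10 F) :=
  Subgroup.closure {g | IsReflection10 g}

theorem reflection10_mem (u : Space10 F) : reflection10 u ∈ reflectionGroup10 F := by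
  by_cases h : form10 u = 0
  · have : reflection10 u = 1 := LinearEquiv.ext fun x => by
      rw [reflection10_apply, h, div_zero, zero_smul, sub_zero]
      rfl
    rw [this]
    exact one_mem _
  · exact Subgroup.subset_closure (isReflection10_iff.mpr ⟨u, h, rfl⟩)

theorem reflectionGroup10_le : reflectionGroup10 F ≤ O10 F := by
  refine (Subgroup.closure_le _).mpr fun g hg => ?_
  obtain ⟨u, -, rfl⟩ := isReflection10_iff.mp hg
  exact reflection10_mem_O10 u

theorem reflection10_eq_self {u x : Space10 F} (h : bil10 x u = 0) : reflection10 u x = x := by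
  rw [reflection10_apply, h, zero_div, zero_smul, sub_zero]

theorem reflection10_sub {x y : Space10 F} (hx : form10 x = 0) (hy : form10 y = 0)
    (hxy : bil10 x y ≠ 0) : reflection10 (x - y) x = y := by
  rw [reflection10_apply, form10_sub, map_sub, bil10_self, hx, hy, mul_zero, zero_add,
    div_self (by simpa using hxy), one_smul, sub_sub_cancel]

/-- The Eichler transformation with singular e and y ⊥ e. The vectors y and y - Q(y)e have the same
nonzero norm, and the product of their reflections is this map. -/
theorem exists_eichler_of_ne_zero {e y : Space10 F} (he : form10 e = 0) (hy : bil10 y e = 0)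
    (hQ : form10 y ≠ 0) : ∃ r ∈ reflectionGroup10 F, ∀ x,
      r x = x + bil10 x e • y - (bil10 x y + form10 y * bil10 x e) • e := by
  refine ⟨reflection10 (y - form10 y • e) * reflection10 y,
    mul_mem (reflection10_mem _) (reflection10_mem _), fun x => ?_⟩
  have hu : form10 (y - form10 y • e) = form10 y := by
    rw [form10_sub, form10_smul, he, map_smul, hy]
    simp
  rw [LinearEquiv.mul_apply, reflection10_apply, reflection10_apply, hu]
  simp only [map_sub, map_smul, LinearMap.sub_apply, LinearMap.smul_apply, hy, bil10_self,
    smul_eq_mul, mul_zero, sub_zero]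
  rw [show (bil10 x y - bil10 x y / form10 y * (2 * form10 y) - form10 y * bil10 x e) / form10 y =
    -(bil10 x y / form10 y) - bil10 x e by field_simp; ring]
  obtain ⟨c, hc⟩ : ∃ c, bil10 x y = c * form10 y := ⟨bil10 x y / form10 y, by field_simp⟩
  rw [hc, mul_div_cancel_right₀ _ hQ]
  module

/-- For fixed e, Eichler transformations compose by adding their parameters in the orthogonal
complement of e; so it suffices to treat parameters that generate additively. -/
theorem exists_eichler_add {e y z : Space10 F} (he : form10 e = 0) (hy : bil10 y e = 0)
    (hz : bil10 z e = 0)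
    (h : ∃ r ∈ reflectionGroup10 F, ∀ x,
      r x = x + bil10 x e • y - (bil10 x y + form10 y * bil10 x e) • e)
    (h' : ∃ r ∈ reflectionGroup10 F, ∀ x,
      r x = x + bil10 x e • z - (bil10 x z + form10 z * bil10 x e) • e) :
    ∃ r ∈ reflectionGroup10 F, ∀ x, r x = x + bil10 x e • (y + z) -
      (bil10 x (y + z) + form10 (y + z) * bil10 x e) • e := by
  obtain ⟨r, hr, h⟩ := h
  obtain ⟨r', hr', h'⟩ := h'
  refine ⟨r * r', mul_mem hr hr', fun x => ?_⟩
  rw [LinearEquiv.mul_apply, h, h']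
  simp only [map_sub, map_add, map_smul, LinearMap.sub_apply, LinearMap.add_apply,
    LinearMap.smul_apply, hz, bil10_self, he, smul_eq_mul, mul_zero, sub_zero, add_zero,
    bil10_comm e y, hy, form10_add, bil10_comm z y]
  module

/-- The parameter z may be singular, so it is split into coordinate vectors, and each of these into
two vectors of norm 1. The argument works over every field, including the one with two elements. -/
theorem exists_eichler (k : Fin 5) {z : Space10 F} (hz : ∀ s, z (k, s) = 0) :
    ∃ r ∈ reflectionGroup10 F, ∀ x, r x = x + bil10 x (Pi.single (k, true) 1) • z -
      (bil10 x z + form10 z * bil10 x (Pi.single (k, true) 1)) • Pi.single (k, true) 1 := by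
  set e : Space10 F := Pi.single (k, true) 1 with he_def
  have he : form10 e = 0 := form10_single k true
  have key : ∀ T : Finset (Fin 5 × Bool), (∀ j ∈ T, j.1 ≠ k) →
      bil10 (∑ j ∈ T, Pi.single j (z j)) e = 0 ∧ ∃ r ∈ reflectionGroup10 F, ∀ x, r x = x +
        bil10 x e • (∑ j ∈ T, Pi.single j (z j)) - (bil10 x (∑ j ∈ T, Pi.single j (z j)) +
          form10 (∑ j ∈ T, Pi.single j (z j)) * bil10 x e) • e := by
    intro T
    induction T using Finset.induction_on with
    | empty =>
      intro _
      refine ⟨by simp, 1, one_mem _, fun x => ?_⟩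
      simp [form10]
    | insert j T hj ih =>
      intro hT
      obtain ⟨ih0, ih1⟩ := ih fun i hi => hT i (Finset.mem_insert_of_mem hi)
      have hjk : j.1 ≠ k := hT j (Finset.mem_insert_self _ _)
      rw [Finset.sum_insert hj]
      have hje (c : F) : bil10 (Pi.single j c) e = 0 := by
        rw [he_def, bil10_single, Pi.single_eq_of_ne]
        exact fun h => hjk (congrArg Prod.fst h).symm
      refine ⟨by rw [map_add, LinearMap.add_apply, hje, ih0, add_zero], ?_⟩
      refine exists_eichler_add he (hje _) ih0 ?_ ih1
      -- A third hyperbolic plane contains y with Q(y) = 1 orthogonal both to e and to the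
      -- coordinate vector; then that vector is the sum of (itself + y) and -y, both of norm 1.
      obtain ⟨m, hmk, hmj⟩ : ∃ m : Fin 5, m ≠ k ∧ m ≠ j.1 := by
        have : ∀ a b : Fin 5, ∃ m, m ≠ a ∧ m ≠ b := by decide
        exact this _ _
      set y : Space10 F := Pi.single (m, true) 1 + Pi.single (m, false) 1 with hy
      have hye : bil10 y e = 0 := by
        simp [he_def, bil10_single, hy, hmk.symm]
      have hQy : form10 y = 1 := by
        rw [hy, form10_add, form10_single, form10_single, bil10_single]
        simp
      obtain ⟨j1, j2⟩ := j
      have hsing : (Pi.single (j1, j2) (z (j1, j2)) : Space10 F) =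
          z (j1, j2) • Pi.single (j1, j2) 1 := by
        rw [← Pi.single_smul]; simp
      have hQ : form10 (Pi.single (j1, j2) (z (j1, j2)) + y) = 1 := by
        rw [form10_add, hsing, form10_smul, form10_single, hQy, bil10_comm, map_smul, hy,
          map_add, LinearMap.add_apply, bil10_single, bil10_single]
        simp [hmj.symm]
      rw [show (Pi.single (j1, j2) (z (j1, j2)) : Space10 F) =
        (Pi.single (j1, j2) (z (j1, j2)) + y) + -y by abel]
      have hy' : bil10 (Pi.single (j1, j2) (z (j1, j2)) + y) e = 0 := by
        rw [map_add, LinearMap.add_apply, hje, hye, add_zero]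
      have hny : bil10 (-y) e = 0 := by rw [map_neg, LinearMap.neg_apply, hye, neg_zero]
      exact exists_eichler_add he hy' hny
        (exists_eichler_of_ne_zero he hy' (by rw [hQ]; exact one_ne_zero))
        (exists_eichler_of_ne_zero he hny (by rw [form10_neg, hQy]; exact one_ne_zero))
  have hsum : ∑ j ∈ Finset.univ.filter (fun j : Fin 5 × Bool => j.1 ≠ k), Pi.single j (z j) =
      z := by
    conv_rhs => rw [← Finset.univ_sum_single z]
    refine Finset.sum_subset (Finset.filter_subset _ _) fun j _ hj => ?_
    have : j.1 = k := by simpa using hj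
    obtain ⟨j1, j2⟩ := j
    subst this
    rw [hz, Pi.single_zero]
  have := (key (Finset.univ.filter fun j => j.1 ≠ k) fun j hj => (Finset.mem_filter.mp hj).2).2
  rwa [hsum] at this

/-- Singular vectors in the span of the hyperbolic planes from `k` on are conjugate under
reflections that fix the first `k` planes. -/
theorem exists_reflections_apply_eq (k : Fin 5) {x : Space10 F} (hx : x ≠ 0)
    (hQ : form10 x = 0) (hk : ∀ i < k, ∀ s, x (i, s) = 0) :
    ∃ r ∈ reflectionGroup10 F, r x = Pi.single (k, true) 1 ∧
      ∀ i < k, ∀ s, r (Pi.single (i, s) 1) = Pi.single (i, s) 1 := by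
  have fix {u : Space10 F} (hu : ∀ i < k, ∀ s, u (i, s) = 0) : ∀ i < k, ∀ s,
      reflection10 u (Pi.single (i, s) 1) = Pi.single (i, s) 1 := fun i hi s => by
    refine reflection10_eq_self ?_
    rw [bil10_comm, bil10_single, hu i hi]
  have hne {i : Fin 5} (hi : i < k) (s t : Bool) : (i, s) ≠ (k, t) :=
    fun h => hi.ne (congrArg Prod.fst h)
  set e : Space10 F := Pi.single (k, true) 1 with he
  have hek : ∀ i < k, ∀ s, e (i, s) = 0 := fun i hi s => Pi.single_eq_of_ne (hne hi _ _) _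
  by_cases h : x (k, false) = 0
  -- Here x is orthogonal to e, so no single reflection of the form x - e is available; the route
  -- goes through a singular w orthogonal to neither.
  · obtain ⟨w, hwk, hwQ, hwx, hwe⟩ : ∃ w : Space10 F, (∀ i < k, ∀ s, w (i, s) = 0) ∧
        form10 w = 0 ∧ bil10 x w ≠ 0 ∧ bil10 w e ≠ 0 := by
      by_cases h' : x (k, true) = 0
      · obtain ⟨⟨j, s⟩, hj⟩ := Function.ne_iff.mp hx
        have hjk : j ≠ k := by
          rintro rfl
          rcases s with _ | _
          exacts [hj h, hj h']
        have hkj : k < j := lt_of_le_of_ne (not_lt.mp fun hlt => hj (hk j hlt s)) hjk.symm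
        refine ⟨Pi.single (k, false) 1 + Pi.single (j, !s) 1, fun i hi t => ?_, ?_, ?_, ?_⟩
        · rw [Pi.add_apply, Pi.single_eq_of_ne (hne hi _ _), Pi.single_eq_of_ne, add_zero]
          exact fun hh => (hi.trans hkj).ne (congrArg Prod.fst hh)
        · rw [form10_add, form10_single, form10_single, bil10_single]
          simp [hjk]
        · rw [map_add, bil10_single, bil10_single]
          simpa [h'] using hj
        · rw [he, bil10_single]
          simp [hjk.symm]
      · refine ⟨Pi.single (k, false) 1, fun i hi t => Pi.single_eq_of_ne (hne hi _ _) _,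
          form10_single _ _, ?_, ?_⟩
        · rw [bil10_single]
          exact h'
        · rw [he, bil10_single]
          simp
    have he0 : form10 e = 0 := form10_single _ _
    refine ⟨reflection10 (w - e) * reflection10 (x - w),
      mul_mem (reflection10_mem _) (reflection10_mem _), ?_, fun i hi s => ?_⟩
    · rw [LinearEquiv.mul_apply, reflection10_sub hQ hwQ hwx, reflection10_sub hwQ he0 hwe]
    · rw [LinearEquiv.mul_apply, fix _ i hi s, fix _ i hi s]
      · exact fun i hi s => by rw [Pi.sub_apply, hwk i hi, hek i hi, sub_zero]
      · exact fun i hi s => by rw [Pi.sub_apply, hwk i hi, hk i hi, sub_zero]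
  · refine ⟨reflection10 (x - e), reflection10_mem _, ?_, fix fun i hi s => ?_⟩
    · refine reflection10_sub hQ (form10_single _ _) ?_
      rwa [he, bil10_single]
    · rw [Pi.sub_apply, hk i hi, hek i hi, sub_zero]

/-- The inductive step of a Witt type argument. Once the first vector e of plane k is restored, the
image of its partner f has the form f + z - Q(z)e with z supported on later planes. This is the
image of f under the Eichler transformation with parameter z, whose inverse restores f and disturbs
neither e nor the earlier planes. -/
theorem exists_reflections_fix_plane (k : Fin 5) {g : Space10 F ≃ₗ[F] Space10 F}
    (hg : g ∈ O10 F) (hk : ∀ i < k, ∀ s, g (Pi.single (i, s) 1) = Pi.single (i, s) 1) :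
    ∃ r ∈ reflectionGroup10 F, ∀ i ≤ k, ∀ s,
      (r * g) (Pi.single (i, s) 1) = Pi.single (i, s) 1 := by
  have supp {g : Space10 F ≃ₗ[F] Space10 F} (hg : g ∈ O10 F)
      (hk : ∀ i < k, ∀ s, g (Pi.single (i, s) 1) = Pi.single (i, s) 1) (t : Bool) :
      ∀ i < k, ∀ s, g (Pi.single (k, t) 1) (i, s) = 0 := fun i hi s => by
    have h1 := bil10_single (g (Pi.single (k, t) 1)) i (!s)
    rw [← hk i hi, bil10_map hg, bil10_single, Bool.not_not] at h1
    rw [← h1, Pi.single_eq_of_ne]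
    exact fun h => hi.ne (congrArg Prod.fst h)
  have hQ {g : Space10 F ≃ₗ[F] Space10 F} (hg : g ∈ O10 F) (t : Bool) :
      form10 (g (Pi.single (k, t) 1)) = 0 := (hg _).trans (form10_single k t)
  obtain ⟨r, hr, hr1, hr2⟩ := exists_reflections_apply_eq k
    (x := g (Pi.single (k, true) 1)) (by simp) (hQ hg true) (supp hg hk true)
  have hg' : r * g ∈ O10 F := mul_mem (reflectionGroup10_le hr) hg
  have hk' : ∀ i < k, ∀ s, (r * g) (Pi.single (i, s) 1) = Pi.single (i, s) 1 := fun i hi s => by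
    rw [LinearEquiv.mul_apply, hk i hi, hr2 i hi]
  set f := (r * g) (Pi.single (k, false) 1) with hf
  have hf1 : f (k, false) = 1 := by
    have h1 := bil10_map hg' (Pi.single (k, false) 1) (Pi.single (k, true) 1)
    rw [← hf, LinearEquiv.mul_apply, hr1, bil10_single, bil10_single] at h1
    simpa using h1
  set z : Space10 F := f - Pi.single (k, true) (f (k, true)) - Pi.single (k, false) 1 with hz
  have hzk : ∀ s, z (k, s) = 0 := by
    rintro (_ | _) <;> simp [hz, hf1]
  have hzi : ∀ i < k, ∀ s, z (i, s) = 0 := fun i hi s => by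
    have := supp hg' hk' false i hi s
    rw [← hf] at this
    rw [hz, Pi.sub_apply, Pi.sub_apply, this, Pi.single_eq_of_ne, Pi.single_eq_of_ne] <;>
    simp [hi.ne]
  have hfz : f = z + f (k, true) • Pi.single (k, true) 1 + Pi.single (k, false) 1 := by
    rw [hz, ← Pi.single_smul, smul_eq_mul, mul_one]
    abel
  have hzb (s) : bil10 z (Pi.single (k, s) 1) = 0 := by rw [bil10_single, hzk]
  -- The image of a singular vector is singular, which fixes its coefficient at e.
  have hft : f (k, true) = -form10 z := by
    have h1 := hQ hg' false
    rw [← hf, hfz, form10_add, form10_add, form10_smul, form10_single, form10_single,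
      map_smul, hzb, map_add, LinearMap.add_apply, hzb, map_smul, LinearMap.smul_apply,
      bil10_single] at h1
    simp at h1
    linear_combination h1
  obtain ⟨ρ, hρ, hρ'⟩ := exists_eichler k hzk
  have inv {x y : Space10 F} (h : ρ x = y) : ρ⁻¹ y = x := by
    rw [← h]
    exact LinearEquiv.symm_apply_apply ρ x
  refine ⟨ρ⁻¹ * r, mul_mem (inv_mem hρ) hr, fun i hi s => ?_⟩
  rw [mul_assoc, LinearEquiv.mul_apply]
  rcases hi.lt_or_eq with hi | rfl
  · rw [hk' i hi]
    refine inv ?_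
    rw [hρ', bil10_comm _ z, bil10_single, bil10_single, hzi i hi, Pi.single_eq_of_ne]
    · simp
    · exact fun h => hi.ne (congrArg Prod.fst h).symm
  · rcases s with _ | _
    · rw [← hf]
      refine inv ?_
      rw [hρ', bil10_comm _ z, hzb, bil10_single, hfz, hft]
      simp
      module
    · rw [LinearEquiv.mul_apply, hr1]
      refine inv ?_
      rw [hρ', bil10_comm _ z, hzb, bil10_single]
      simp

/-- The orthogonal group is generated by reflections. -/
theorem O10_eq_reflectionGroup10 : O10 F = reflectionGroup10 F := by
  refine le_antisymm (fun g hg => ?_) reflectionGroup10_le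
  have key : ∀ n : ℕ, n ≤ 5 → ∃ r ∈ reflectionGroup10 F, ∀ i : Fin 5, i.val < n → ∀ s,
      (r * g) (Pi.single (i, s) 1) = Pi.single (i, s) 1 := by
    intro n
    induction n with
    | zero => exact fun _ => ⟨1, one_mem _, fun i hi => absurd hi (Nat.not_lt_zero _)⟩
    | succ n ih =>
      intro hn
      obtain ⟨r, hr, h⟩ := ih (by omega)
      obtain ⟨r', hr', h'⟩ := exists_reflections_fix_plane ⟨n, hn⟩
        (mul_mem (reflectionGroup10_le hr) hg) fun i hi => h i hi
      exact ⟨r' * r, mul_mem hr' hr, fun i hi s => by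
        rw [mul_assoc]; exact h' i (Nat.lt_succ_iff.mp hi) s⟩
  obtain ⟨r, hr, h⟩ := key 5 le_rfl
  have : r * g = 1 := by
    refine LinearEquiv.toLinearMap_injective (LinearMap.pi_ext' fun i => LinearMap.ext_ring ?_)
    exact h i.1 i.1.isLt i.2
  rw [eq_inv_of_mul_eq_one_right this]
  exact inv_mem hr

/-- The group generated by the products of two reflections. -/
def evenReflectionGroup10 (F : Type*) [Field F] : Subgroup (Space10 F ≃ₗ[F] Space10 F) :=
  Subgroup.closure {g | ∃ r s, IsReflection10 r ∧ IsReflection10 s ∧ g = r * s}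

/-- The even products have index at most 2 among isometries, and any reflection represents the other
coset. -/
theorem mem_evenReflectionGroup10_or {r g : Space10 F ≃ₗ[F] Space10 F} (hr : IsReflection10 r)
    (hg : g ∈ O10 F) : g ∈ evenReflectionGroup10 F ∨ r * g ∈ evenReflectionGroup10 F := by
  have inv {s : Space10 F ≃ₗ[F] Space10 F} (hs : IsReflection10 s) : s * s = 1 := by
    obtain ⟨u, -, rfl⟩ := isReflection10_iff.mp hs
    exact reflection10_mul_self u
  have step {s y : Space10 F ≃ₗ[F] Space10 F} (hs : IsReflection10 s)
      (hy : y ∈ evenReflectionGroup10 F ∨ r * y ∈ evenReflectionGroup10 F) :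
      s * y ∈ evenReflectionGroup10 F ∨ r * (s * y) ∈ evenReflectionGroup10 F := by
    rcases hy with hy | hy
    · right
      rw [← mul_assoc]
      exact mul_mem (Subgroup.subset_closure ⟨r, s, hr, hs, rfl⟩) hy
    · left
      have : s * y = s * r * (r * y) := by
        rw [mul_assoc, ← mul_assoc r r, inv hr, one_mul]
      rw [this]
      exact mul_mem (Subgroup.subset_closure ⟨s, r, hs, hr, rfl⟩) hy
  rw [O10_eq_reflectionGroup10] at hg
  refine Subgroup.closure_induction_left (p := fun g _ => g ∈ evenReflectionGroup10 F ∨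
    r * g ∈ evenReflectionGroup10 F) (Or.inl (one_mem _)) (fun s hs y _ hy => step hs hy)
    (fun s hs y _ hy => ?_) hg
  rw [show s⁻¹ = s from inv_eq_of_mul_eq_one_right (inv hs)]
  exact step hs hy

theorem evenReflectionGroup10_le_spinLiftable : evenReflectionGroup10 F ≤ spinLiftable F := by
  refine (Subgroup.closure_le _).mpr ?_
  rintro g ⟨r, s, hr, hs, rfl⟩
  exact hr.mul_mem_spinLiftable hs

/-- Isometries that lift to the half spin space are products of even numbers of reflections. -/
theorem mem_evenReflectionGroup10 {g : Space10 F ≃ₗ[F] Space10 F} (hg : g ∈ O10 F)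
    (hl : g ∈ spinLiftable F) : g ∈ evenReflectionGroup10 F := by
  -- The reflection in (1, -1, 0) exchanges the first two coordinates, which is the map excluded by
  -- `not_mem_spinLiftable`. If g were odd, this reflection times g would lift, hence so would the
  -- reflection. The argument separates the two cosets even where the determinant is always 1.
  have hu : form10 (space10Mk 1 (-1) 0 : Space10 F) = -1 := by
    rw [form10_eq]
    simp [octNorm]
  have hr : IsReflection10 (reflection10 (space10Mk 1 (-1) 0 : Space10 F)) :=
    isReflection10_iff.mpr ⟨_, by rw [hu]; simp, rfl⟩
  refine (mem_evenReflectionGroup10_or hr hg).resolve_right fun h => ?_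
  have h' := mul_mem (evenReflectionGroup10_le_spinLiftable h) (inv_mem hl)
  rw [mul_inv_cancel_right] at h'
  refine not_mem_spinLiftable (fun a b C => ?_) h'
  rw [reflection10_apply, hu]
  have hb : bil10 (space10Mk a b C) (space10Mk 1 (-1) 0) = b - a := by
    simp [bil10_apply, Fin.sum_univ_succ, space10Mk]
    ring
  rw [hb, div_neg, div_one]
  funext ⟨i, s⟩
  fin_cases i <;> rcases s with _ | _ <;> simp [space10Mk]

end Orthogonal

/-! ### Similitudes -/

section Similitudes

variable {F : Type*} [Field F]

/-- The similitude that multiplies one coordinate of each hyperbolic plane by `μ`. -/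
def scaling10 (μ : Fˣ) : Space10 F ≃ₗ[F] Space10 F :=
  LinearEquiv.piCongrRight fun i => LinearEquiv.smulOfUnit (if i.2 then 1 else μ)

theorem scaling10_true (μ : Fˣ) (x : Space10 F) (i : Fin 5) :
    scaling10 μ x (i, true) = x (i, true) := by
  simp [scaling10, LinearEquiv.smulOfUnit]

theorem scaling10_false (μ : Fˣ) (x : Space10 F) (i : Fin 5) :
    scaling10 μ x (i, false) = μ * x (i, false) := by
  simp [scaling10, LinearEquiv.smulOfUnit, Units.smul_def]

theorem form10_scaling10 (μ : Fˣ) (x : Space10 F) : form10 (scaling10 μ x) = μ * form10 x := by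
  simp only [form10, scaling10_true, scaling10_false, Finset.mul_sum]
  exact Finset.sum_congr rfl fun i _ => by ring

theorem det_scaling10 (μ : Fˣ) : LinearEquiv.det (scaling10 μ : Space10 F ≃ₗ[F] Space10 F) =
    μ ^ 5 := by
  ext
  have : (scaling10 μ : Space10 F ≃ₗ[F] Space10 F).toLinearMap =
      Matrix.toLin' (Matrix.diagonal fun i : Fin 5 × Bool => if i.2 then (1 : F) else μ) := by
    refine LinearMap.ext fun x => funext fun i => ?_
    obtain ⟨i, s⟩ := i
    rcases s with _ | _
    · simpa [Matrix.mulVec_diagonal] using scaling10_false μ x i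
    · simpa [Matrix.mulVec_diagonal] using scaling10_true μ x i
  rw [LinearEquiv.coe_det, this, LinearMap.det_toLin', Matrix.det_diagonal,
    Fintype.prod_prod_type]
  simp

/-- The lift of `scaling10 μ` to the half spin space. -/
def spinScaling (μ : Fˣ) : HalfSpin F ≃ₗ[F] HalfSpin F :=
  (LinearEquiv.piCongrRight fun i => LinearEquiv.smulOfUnit
    (if i.2 = none then if i.1 then μ ^ 2 else 1 else μ)).prodCongr
  (LinearEquiv.piCongrRight fun i => LinearEquiv.smulOfUnit
    (if i.2 = none then if i.1 then 1 else μ else if i.1 then μ else 1))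

/-- The exponents in `spinScaling` are chosen so that every monomial of the trilinear form acquires
the same factor μ². This gives a lifting similitude for each multiplier, so that general similitudes
reduce to isometries. -/
theorem scaling10_mem_spinLiftable (μ : Fˣ) :
    (scaling10 μ : Space10 F ≃ₗ[F] Space10 F) ∈ spinLiftable F := by
  refine mem_spinLiftable_iff.mpr ⟨spinScaling μ, μ ^ 2, fun v s t => ?_⟩
  have hA (s : HalfSpin F) (i) : (spinScaling μ s).1 i =
      (if i.2 = none then if i.1 then (μ : F) ^ 2 else 1 else μ) * s.1 i := by
    obtain ⟨_ | _, _ | _⟩ := i <;>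
      simp [spinScaling, LinearEquiv.smulOfUnit, Units.smul_def]
  have hB (s : HalfSpin F) (i) : (spinScaling μ s).2 i =
      (if i.2 = none then if i.1 then 1 else (μ : F) else if i.1 then (μ : F) else 1) * s.2 i := by
    obtain ⟨_ | _, _ | _⟩ := i <;>
      simp [spinScaling, LinearEquiv.smulOfUnit, Units.smul_def]
  have hC (v : Space10 F) (i : OctIdx) : space10Oct (scaling10 μ v) i =
      (if i.1 then 1 else (μ : F)) * space10Oct v i := by
    obtain ⟨_ | _, k⟩ := i <;> simp [space10Oct, scaling10_true, scaling10_false]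
  simp only [spinPairing_clifford, octPolar_eq, octTrace, octMul_true_none, octMul_false_none,
    octMul_true_zero, octMul_true_one, octMul_true_two, octMul_false_zero, octMul_false_one,
    octMul_false_two, hA, hB, hC, scaling10_true, scaling10_false, Units.val_pow_eq_pow_val]
  simp
  ring

theorem det_reflection10 {u : Space10 F} (hu : form10 u ≠ 0) :
    LinearEquiv.det (reflection10 u) = -1 := by
  ext
  have : (reflection10 u).toLinearMap =
      LinearMap.transvection (-((form10 u)⁻¹ • bil10.flip u)) u := by
    refine LinearMap.ext fun x => ?_
    rw [LinearEquiv.coe_coe, reflection10_apply, LinearMap.transvection.apply]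
    simp [div_eq_inv_mul, sub_eq_add_neg]
  rw [LinearEquiv.coe_det, this, LinearMap.transvection.det]
  simp only [LinearMap.neg_apply, LinearMap.smul_apply, LinearMap.flip_apply, bil10_self,
    smul_eq_mul, Units.val_neg, Units.val_one]
  rw [show (form10 u)⁻¹ * (2 * form10 u) = 2 by field_simp]
  ring

theorem det_of_mem_evenReflectionGroup10 {g : Space10 F ≃ₗ[F] Space10 F}
    (hg : g ∈ evenReflectionGroup10 F) : LinearEquiv.det g = 1 := by
  have : evenReflectionGroup10 F ≤ (LinearEquiv.det (R := F) (M := Space10 F)).ker := by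
    refine (Subgroup.closure_le _).mpr ?_
    rintro g ⟨r, s, hr, hs, rfl⟩
    obtain ⟨u, hu, rfl⟩ := isReflection10_iff.mp hr
    obtain ⟨w, hw, rfl⟩ := isReflection10_iff.mp hs
    simp [MonoidHom.mem_ker, map_mul, det_reflection10 hu, det_reflection10 hw]
  exact this hg

theorem scaling10_inv_mul_mem_O10 {g : Space10 F ≃ₗ[F] Space10 F} {μ : Fˣ}
    (hg : ∀ x, form10 (g x) = μ * form10 x) : (scaling10 μ)⁻¹ * g ∈ O10 F := by
  intro x
  refine mul_left_cancel₀ μ.ne_zero ?_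
  rw [← form10_scaling10, ← hg]
  exact congrArg form10 ((scaling10 μ).apply_symm_apply (g x))

/-- Division by the standard similitude leaves a lifting isometry, which is an even product of
reflections and has determinant 1; the factor μ^5 comes from the standard similitude. -/
theorem det_eq_of_mem_spinLiftable {g : Space10 F ≃ₗ[F] Space10 F} {μ : Fˣ}
    (hg : ∀ x, form10 (g x) = μ * form10 x) (hl : g ∈ spinLiftable F) :
    LinearEquiv.det g = μ ^ 5 := by
  have := det_of_mem_evenReflectionGroup10 (mem_evenReflectionGroup10
    (scaling10_inv_mul_mem_O10 hg) (mul_mem (inv_mem (scaling10_mem_spinLiftable μ)) hl))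
  rwa [map_mul, map_inv, det_scaling10, inv_mul_eq_one, eq_comm] at this

theorem mem_center_space10_iff {g : Space10 F ≃ₗ[F] Space10 F} :
    g ∈ Subgroup.center (Space10 F ≃ₗ[F] Space10 F) ↔ ∃ c : Fˣ, ∀ x, g x = (c : F) • x := by
  rw [Subgroup.mem_center_iff]
  constructor
  · intro h
    -- Commutation with the elementary transvection that adds the j-th coordinate to the i-th,
    -- evaluated at the j-th basis vector.
    have key {i j : Fin 5 × Bool} (hij : j ≠ i) :
        g (Pi.single i 1) = g (Pi.single j 1) j • Pi.single i 1 := by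
      have h0 : (LinearMap.proj j : Space10 F →ₗ[F] F) (Pi.single i 1) = 0 := by simp [hij]
      have h1 := LinearEquiv.congr_fun (h (LinearEquiv.transvection h0)) (Pi.single j 1)
      simp only [LinearEquiv.mul_apply, LinearEquiv.transvection.apply, map_add, map_smul] at h1
      simpa using h1.symm
    set i₀ : Fin 5 × Bool := (0, true)
    set c := g (Pi.single i₀ 1) i₀ with hc
    have h1 (i) : g (Pi.single i 1) = c • Pi.single i 1 := by
      by_cases hi : i₀ = i
      · subst hi
        have e := key (i := i₀) (j := (0, false)) (by simp [i₀])
        rw [hc, e]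
        simp
      · exact key hi
    have hg (x) : g x = c • x := by
      have : g.toLinearMap = c • LinearMap.id :=
        LinearMap.pi_ext' fun i => LinearMap.ext_ring (by simpa using h1 i)
      exact LinearMap.congr_fun this x
    have hc0 : c ≠ 0 := by
      intro h0
      have := (hg (Pi.single i₀ 1)).symm
      rw [h0, zero_smul, eq_comm, LinearEquiv.map_eq_zero_iff] at this
      simpa using congrFun this i₀
    exact ⟨Units.mk0 c hc0, hg⟩
  · rintro ⟨c, hc⟩ h
    refine LinearEquiv.ext fun x => ?_
    rw [LinearEquiv.mul_apply, LinearEquiv.mul_apply, hc, hc, map_smul]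

/-- Multiplication by a scalar. -/
def scalar10 (c : Fˣ) : Space10 F ≃ₗ[F] Space10 F := LinearEquiv.smulOfUnit c

theorem scalar10_apply (c : Fˣ) (x : Space10 F) : scalar10 c x = (c : F) • x := rfl

theorem scalar10_mem_center (c : Fˣ) :
    scalar10 c ∈ Subgroup.center (Space10 F ≃ₗ[F] Space10 F) :=
  mem_center_space10_iff.mpr ⟨c, scalar10_apply c⟩

theorem scalar10_mem_GSO10 (c : Fˣ) : (scalar10 c : Space10 F ≃ₗ[F] Space10 F) ∈ GSO10 F := by
  refine ⟨c ^ 2, fun x => ?_, ?_⟩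
  · rw [scalar10_apply, form10_smul, Units.val_pow_eq_pow_val]
  · ext
    have : (scalar10 c : Space10 F ≃ₗ[F] Space10 F).toLinearMap = (c : F) • LinearMap.id := rfl
    rw [LinearEquiv.coe_det, this, LinearMap.det_smul]
    simp
    ring

theorem SO10_eq_of_ringChar_eq_two (h : ringChar F = 2) : SO10 F = evenReflectionGroup10 F := by
  rw [SO10, if_pos h, evenReflectionGroup10]

theorem mem_SO10_of_ringChar_ne_two (h : ringChar F ≠ 2) {g : Space10 F ≃ₗ[F] Space10 F} :
    g ∈ SO10 F ↔ g ∈ O10 F ∧ LinearEquiv.det g = 1 := by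
  rw [SO10, if_neg h, Subgroup.mem_inf, MonoidHom.mem_ker]

/-- Both sides are compared with the proper similitudes. Coset representatives times scalars inject
into them; conversely a proper similitude is determined by its multiplier and by the isometry of
determinant 1 left after dividing by the standard similitude. -/
theorem card_PGSO10_le [Finite F] (h : ringChar F ≠ 2) :
    Nat.card (PGSO10 F) ≤ Nat.card (SO10 F) := by
  have : Finite (Space10 F ≃ₗ[F] Space10 F) := Finite.of_injective _ DFunLike.coe_injective
  have hpos : 0 < Nat.card Fˣ := Nat.card_pos
  refine Nat.le_of_mul_le_mul_right ?_ hpos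
  rw [← Nat.card_prod, ← Nat.card_prod]
  have hp (p : PGSO10 F) : ∃ g ∈ GSO10 F, QuotientGroup.mk' _ g = p.1 :=
    Subgroup.mem_map.mp p.2
  choose rep hrep hmk using hp
  have h1 : Nat.card (PGSO10 F × Fˣ) ≤ Nat.card (GSO10 F) := by
    refine Nat.card_le_card_of_injective
      (fun x => ⟨scalar10 x.2 * rep x.1, mul_mem (scalar10_mem_GSO10 _) (hrep _)⟩) ?_
    rintro ⟨p, c⟩ ⟨p', c'⟩ e
    have e : scalar10 c * rep p = scalar10 c' * rep p' := congrArg Subtype.val e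
    have e' := congrArg (QuotientGroup.mk' (Subgroup.center (Space10 F ≃ₗ[F] Space10 F))) e
    have hs (c : Fˣ) : QuotientGroup.mk' (Subgroup.center (Space10 F ≃ₗ[F] Space10 F))
        (scalar10 c) = 1 := (QuotientGroup.eq_one_iff _).mpr (scalar10_mem_center c)
    rw [map_mul, map_mul, hs, hs, one_mul, one_mul, hmk, hmk] at e'
    obtain rfl := Subtype.ext e'
    have e'' := LinearEquiv.congr_fun (mul_right_cancel e) (Pi.single (0, true) 1)
    have := congrFun e'' (0, true)
    simp only [scalar10_apply, Pi.smul_apply, Pi.single_eq_same, smul_eq_mul, mul_one] at this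
    rw [Units.ext this]
  have hg (g : GSO10 F) : ∃ μ : Fˣ, (∀ x, form10 (g.1 x) = μ * form10 x) ∧
    LinearEquiv.det g.1 = μ ^ 5 := g.2
  choose m hm hm' using hg
  have h2 : Nat.card (GSO10 F) ≤ Nat.card (SO10 F × Fˣ) := by
    refine Nat.card_le_card_of_injective (fun g => (⟨(scaling10 (m g))⁻¹ * g.1,
      (mem_SO10_of_ringChar_ne_two h).mpr ⟨scaling10_inv_mul_mem_O10 (hm g), ?_⟩⟩, m g)) ?_
    · rw [map_mul, map_inv, det_scaling10, hm', inv_mul_cancel]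
    · intro g g' e
      obtain ⟨e1, e2⟩ := Prod.mk.inj e
      have e1 := congrArg Subtype.val e1
      simp only [e2] at e1
      exact Subtype.ext (mul_left_cancel e1)
  exact h1.trans h2

end Similitudes

/-! ### The stabilizer of the standard white point -/

section Stabilizer

/-- The element `(a, b, c ∣ A, B, C)`. -/
def albertMk {R : Type*} (a b c : R) (A B C : SplitOct R) : Albert R :=
  Sum.elim ![a, b, c] fun p => ![A, B, C] p.1 p.2

section Coordinates

variable {R : Type*} (a b c : R) (A B C : SplitOct R)

@[simp] theorem albertMk_zero : albertMk a b c A B C (Sum.inl 0) = a := rfl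

@[simp] theorem albertMk_one : albertMk a b c A B C (Sum.inl 1) = b := rfl

@[simp] theorem albertMk_two : albertMk a b c A B C (Sum.inl 2) = c := rfl

@[simp] theorem albertOff_albertMk_zero : albertOff (albertMk a b c A B C) 0 = A := rfl

@[simp] theorem albertOff_albertMk_one : albertOff (albertMk a b c A B C) 1 = B := rfl

@[simp] theorem albertOff_albertMk_two : albertOff (albertMk a b c A B C) 2 = C := rfl

theorem albert_ext {X Y : Albert R} (h : ∀ n, X (Sum.inl n) = Y (Sum.inl n))
    (h0 : albertOff X 0 = albertOff Y 0) (h1 : albertOff X 1 = albertOff Y 1)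
    (h2 : albertOff X 2 = albertOff Y 2) : X = Y := by
  funext i
  rcases i with n | ⟨n, i⟩
  · exact h n
  · fin_cases n
    exacts [congrFun h0 i, congrFun h1 i, congrFun h2 i]

theorem albertMk_eq (X : Albert R) : albertMk (X (Sum.inl 0)) (X (Sum.inl 1)) (X (Sum.inl 2))
    (albertOff X 0) (albertOff X 1) (albertOff X 2) = X := by
  refine albert_ext (fun n => ?_) rfl rfl rfl
  fin_cases n <;> rfl

end Coordinates

variable {F : Type*} [Field F]

@[simp] theorem albertOff_add (X Y : Albert F) (n : Fin 3) :
    albertOff (X + Y) n = albertOff X n + albertOff Y n := rfl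

@[simp] theorem albertOff_smul (c : F) (X : Albert F) (n : Fin 3) :
    albertOff (c • X) n = c • albertOff X n := rfl

/-- The standard white vector `(0, 0, 1 ∣ 0, 0, 0)`. -/
def whiteVec (F : Type*) [Field F] : Albert F := albertMk 0 0 1 0 0 0

/-- The projection to the coordinates `a`, `b`, `C`. -/
def albertTo10 : Albert F →ₗ[F] Space10 F where
  toFun X := space10Mk (X (Sum.inl 0)) (X (Sum.inl 1)) (albertOff X 2)
  map_add' X Y := by
    funext ⟨i, s⟩
    fin_cases i <;> rcases s with _ | _ <;> simp [space10Mk, add_comm]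
  map_smul' c X := by
    funext ⟨i, s⟩
    fin_cases i <;> rcases s with _ | _ <;> simp [space10Mk]

/-- The inclusion of the coordinates `a`, `b`, `C`. -/
def albertOf10 : Space10 F →ₗ[F] Albert F where
  toFun v := albertMk (v (0, true)) (v (0, false)) 0 0 0 (space10Oct v)
  map_add' v w := by
    refine albert_ext (fun n => ?_) ?_ ?_ ?_ <;> try fin_cases n
    all_goals simp
  map_smul' c v := by
    refine albert_ext (fun n => ?_) ?_ ?_ ?_ <;> try fin_cases n
    all_goals simp

/-- The projection to the coordinates `A`, `B`. -/
def albertTo16 : Albert F →ₗ[F] HalfSpin F where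
  toFun X := (albertOff X 0, albertOff X 1)
  map_add' _ _ := rfl
  map_smul' _ _ := rfl

/-- The inclusion of the coordinates `A`, `B`. -/
def albertOf16 : HalfSpin F →ₗ[F] Albert F where
  toFun s := albertMk 0 0 0 s.1 s.2 0
  map_add' v w := by
    refine albert_ext (fun n => ?_) ?_ ?_ ?_ <;> try fin_cases n
    all_goals simp
  map_smul' c v := by
    refine albert_ext (fun n => ?_) ?_ ?_ ?_ <;> try fin_cases n
    all_goals simp

@[simp] theorem albertTo10_albertOf10 (v : Space10 F) : albertTo10 (albertOf10 v) = v :=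
  space10Mk_eq v

@[simp] theorem albertTo16_fst (X : Albert F) : (albertTo16 X).1 = albertOff X 0 := rfl

@[simp] theorem albertTo16_snd (X : Albert F) : (albertTo16 X).2 = albertOff X 1 := rfl

@[simp] theorem albertTo16_albertOf16 (s : HalfSpin F) : albertTo16 (albertOf16 s) = s := rfl

@[simp] theorem albertTo16_albertOf10 (v : Space10 F) : albertTo16 (albertOf10 v) = 0 := rfl

theorem space10Mk_zero : space10Mk 0 0 0 = (0 : Space10 F) := by
  have := space10Mk_eq (0 : Space10 F)
  rwa [map_zero] at this

@[simp] theorem albertTo10_albertOf16 (s : HalfSpin F) : albertTo10 (albertOf16 s) = 0 :=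
  space10Mk_zero

@[simp] theorem albertTo10_whiteVec : albertTo10 (whiteVec F) = 0 := space10Mk_zero

@[simp] theorem albertTo16_whiteVec : albertTo16 (whiteVec F) = 0 := rfl

@[simp] theorem whiteVec_two : whiteVec F (Sum.inl 2) = 1 := rfl

@[simp] theorem albertOf16_two (s : HalfSpin F) : albertOf16 s (Sum.inl 2) = 0 := rfl

@[simp] theorem albertOf10_two (v : Space10 F) : albertOf10 v (Sum.inl 2) = 0 := rfl

theorem albert_decomp (X : Albert F) :
    X = albertOf10 (albertTo10 X) + albertOf16 (albertTo16 X) + X (Sum.inl 2) • whiteVec F := by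
  have h : space10Oct (albertTo10 X) = albertOff X 2 := space10Oct_space10Mk _ _ _
  refine albert_ext (fun n => ?_) ?_ ?_ ?_ <;> try fin_cases n
  all_goals simp [albertOf10, albertOf16, whiteVec, h]
  all_goals simp [albertTo10]

/-- The part of the determinant that is linear in `(a, b, C)` and quadratic in `(A, B)`. -/
def spinCubic (v : Space10 F) (s : HalfSpin F) : F :=
  -(v (0, true) * octNorm s.1) - v (0, false) * octNorm s.2 +
    octTrace (octMul (octMul s.1 s.2) (space10Oct v))

theorem octTrace_add (x y : SplitOct F) : octTrace (x + y) = octTrace x + octTrace y := by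
  simp only [octTrace, Pi.add_apply]
  ring

theorem spinCubic_add (v : Space10 F) (s t : HalfSpin F) :
    spinCubic v (s + t) = spinCubic v s + spinCubic v t + spinPairing (clifford v s) t := by
  rw [spinPairing_clifford]
  simp only [spinCubic, Prod.fst_add, Prod.snd_add, octNorm_add, add_octMul, octMul_add,
    octTrace_add]
  ring

/-- The determinant sorted by powers of the coordinate c: the coefficient of c is the hyperbolic
form, and the remainder carries the spin geometry. -/
theorem albertDet_eq (X : Albert F) : albertDet X =
    X (Sum.inl 2) * form10 (albertTo10 X) + spinCubic (albertTo10 X) (albertTo16 X) := by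
  have h : space10Oct (albertTo10 X) = albertOff X 2 := space10Oct_space10Mk _ _ _
  rw [form10_eq, spinCubic, h]
  simp only [albertDet, albertDiag, albertTo10, albertTo16_fst, albertTo16_snd, LinearMap.coe_mk,
    AddHom.coe_mk,
    space10Mk_true, space10Mk_false]
  ring

theorem bil10_nondegenerate {x : Space10 F} (h : ∀ y, bil10 x y = 0) : x = 0 := by
  funext ⟨i, s⟩
  have := h (Pi.single (i, !s) 1)
  rwa [bil10_single, Bool.not_not] at this

/-- Nonsingular vectors span: a basis vector is the difference of two vectors of norm 1, with the
help of another hyperbolic plane. -/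
theorem eq_zero_of_forall_form10_ne_zero {M : Type*} [AddCommGroup M] [Module F M]
    {L : Space10 F →ₗ[F] M} (h : ∀ v, form10 v ≠ 0 → L v = 0) : L = 0 := by
  refine LinearMap.pi_ext' fun i => LinearMap.ext_ring ?_
  obtain ⟨i, s⟩ := i
  obtain ⟨j, hj⟩ : ∃ j : Fin 5, j ≠ i := exists_ne i
  set y : Space10 F := Pi.single (j, true) 1 + Pi.single (j, false) 1 with hy
  have hQ : form10 y = 1 := by
    rw [hy, form10_add, form10_single, form10_single, bil10_single]
    simp
  have hQ' : form10 (Pi.single (i, s) 1 + y) = 1 := by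
    rw [form10_add, form10_single, hQ, hy, map_add, bil10_single, bil10_single]
    simp [hj]
  have h1 := h _ (by rw [hQ]; exact one_ne_zero)
  have h2 := h _ (by rw [hQ']; exact one_ne_zero)
  rw [map_add, h1, add_zero] at h2
  simpa using h2

theorem linearEquiv_one_apply {M : Type*} [AddCommGroup M] [Module F M] (x : M) :
    (1 : M ≃ₗ[F] M) x = x := rfl

/-- The representation on a complement of an invariant subspace, or on a section of a
filtration. -/
def compressHom {G M V : Type*} [Group G] [AddCommGroup M] [Module F M] [AddCommGroup V]
    [Module F V] (act : G →* (M ≃ₗ[F] M)) (π : M →ₗ[F] V) (ι : V →ₗ[F] M)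
    (hι : ∀ v, π (ι v) = v)
    (h : ∀ g g' v, π (act g (ι (π (act g' (ι v))))) = π (act g (act g' (ι v)))) :
    G →* (V ≃ₗ[F] V) where
  toFun g := LinearEquiv.ofLinearMap (π ∘ₗ (act g).toLinearMap ∘ₗ ι)
    (π ∘ₗ (act g⁻¹).toLinearMap ∘ₗ ι)
    (LinearMap.ext fun v => by
      simp only [LinearMap.comp_apply, LinearEquiv.coe_coe, h, LinearMap.id_apply]
      rw [← LinearEquiv.mul_apply, ← map_mul, mul_inv_cancel, map_one, linearEquiv_one_apply, hι])
    (LinearMap.ext fun v => by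
      simp only [LinearMap.comp_apply, LinearEquiv.coe_coe, h, LinearMap.id_apply]
      rw [← LinearEquiv.mul_apply, ← map_mul, inv_mul_cancel, map_one, linearEquiv_one_apply, hι])
  map_one' := LinearEquiv.ext fun v => by
    simp only [map_one]
    exact hι v
  map_mul' g g' := LinearEquiv.ext fun v => by
    rw [LinearEquiv.mul_apply]
    refine Eq.trans ?_ (h g g' v).symm
    change π (act (g * g') (ι v)) = _
    rw [map_mul, LinearEquiv.mul_apply]

/-- An action by isometries of the determinant that fix the standard white point. -/
structure WhiteAction (F G : Type*) [Field F] [Group G] where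
  /-- The action. -/
  act : G →* (Albert F ≃ₗ[F] Albert F)
  injective : Function.Injective act
  det_act : ∀ g X, albertDet (act g X) = albertDet X
  act_whiteVec : ∀ g, ∃ c : F, act g (whiteVec F) = c • whiteVec F

/-! ### The invariant flag of the stabilizer and its representations in dimensions 10 and 16 -/

namespace WhiteAction

variable {G : Type*} [Group G] (S : WhiteAction F G)

theorem act_act_inv (g : G) (X : Albert F) : S.act g (S.act g⁻¹ X) = X := by
  rw [← LinearEquiv.mul_apply, ← map_mul, mul_inv_cancel, map_one, linearEquiv_one_apply]

theorem act_whiteVec_eq (g : G) :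
    S.act g (whiteVec F) = S.act g (whiteVec F) (Sum.inl 2) • whiteVec F := by
  obtain ⟨c, hc⟩ := S.act_whiteVec g
  rw [hc]
  simp

/-- The character by which the white point is scaled. -/
def character : G →* Fˣ :=
  MonoidHom.toHomUnits
    { toFun := fun g => S.act g (whiteVec F) (Sum.inl 2)
      map_one' := by rw [map_one, linearEquiv_one_apply, whiteVec_two]
      map_mul' := fun g h => by
        rw [map_mul, LinearEquiv.mul_apply, S.act_whiteVec_eq h, map_smul, Pi.smul_apply,
          smul_eq_mul, Pi.smul_apply, whiteVec_two, smul_eq_mul, mul_one, mul_comm] }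

theorem act_whiteVec_eq_character (g : G) :
    S.act g (whiteVec F) = (S.character g : F) • whiteVec F := S.act_whiteVec_eq g

/-- Q of the 10-dimensional part is the increment of the determinant when W is added, and g
multiplies W by the character; comparing increments gives the semi-invariance of Q. -/
theorem character_mul_form10 (g : G) (X : Albert F) :
    S.character g * form10 (albertTo10 (S.act g X)) = form10 (albertTo10 X) := by
  have key (X : Albert F) (c : F) : albertDet (X + c • whiteVec F) =
      albertDet X + c * form10 (albertTo10 X) := by
    rw [albertDet_eq, albertDet_eq]
    simp only [map_add, map_smul, albertTo10_whiteVec, albertTo16_whiteVec, smul_zero, add_zero,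
      Pi.add_apply, Pi.smul_apply, whiteVec_two, smul_eq_mul, mul_one]
    ring
  have h := S.det_act g (X + (1 : F) • whiteVec F)
  rw [one_smul, map_add, act_whiteVec_eq_character, key, S.det_act] at h
  have h' := key X 1
  rw [one_smul] at h'
  rw [h', one_mul] at h
  exact add_left_cancel h

/-- The 17-dimensional kernel is the radical of the polar form of the pulled back Q, and Q is
invariant up to a nonzero factor. -/
theorem albertTo10_act_eq_zero (g : G) {X : Albert F} (hX : albertTo10 X = 0) :
    albertTo10 (S.act g X) = 0 := by
  refine bil10_nondegenerate fun y => ?_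
  set Y := S.act g⁻¹ (albertOf10 y) with hY
  have hy : albertTo10 (S.act g Y) = y := by rw [hY, act_act_inv, albertTo10_albertOf10]
  have h1 := S.character_mul_form10 g (X + Y)
  rw [map_add, map_add, map_add, form10_add, hX, zero_add, mul_add, mul_add,
    S.character_mul_form10, S.character_mul_form10, hX, hy] at h1
  have h2 : (S.character g : F) * bil10 (albertTo10 (S.act g X)) y = 0 := by
    simpa [form10] using h1
  exact (mul_eq_zero.mp h2).resolve_left (Units.ne_zero _)

theorem albertTo10_act (g : G) (X : Albert F) :
    albertTo10 (S.act g (albertOf10 (albertTo10 X))) = albertTo10 (S.act g X) := by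
  have h := S.albertTo10_act_eq_zero g (X := X - albertOf10 (albertTo10 X)) (by simp)
  rw [map_sub, map_sub, sub_eq_zero] at h
  exact h.symm

theorem albertTo16_act (g : G) {X : Albert F} (hX : albertTo10 X = 0) :
    albertTo16 (S.act g (albertOf16 (albertTo16 X))) = albertTo16 (S.act g X) := by
  conv_rhs => rw [albert_decomp X, hX, map_zero, zero_add, map_add, map_smul,
    act_whiteVec_eq_character, map_add, map_smul, map_smul, albertTo16_whiteVec, smul_zero,
    smul_zero, add_zero]

/-- The action on the 10-dimensional quotient. -/
def vecRep : G →* (Space10 F ≃ₗ[F] Space10 F) :=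
  compressHom S.act albertTo10 albertOf10 albertTo10_albertOf10 fun g _ _ =>
    S.albertTo10_act g _

/-- The action on the 16-dimensional section. -/
def spinRep : G →* (HalfSpin F ≃ₗ[F] HalfSpin F) :=
  compressHom S.act albertTo16 albertOf16 albertTo16_albertOf16 fun g g' v =>
    S.albertTo16_act g (S.albertTo10_act_eq_zero g' (albertTo10_albertOf16 v))

theorem vecRep_apply (g : G) (X : Albert F) :
    S.vecRep g (albertTo10 X) = albertTo10 (S.act g X) := S.albertTo10_act g X

theorem spinRep_apply (g : G) (s : HalfSpin F) :
    S.spinRep g s = albertTo16 (S.act g (albertOf16 s)) := rfl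

theorem character_mul_form10_vecRep (g : G) (v : Space10 F) :
    S.character g * form10 (S.vecRep g v) = form10 v := by
  have := S.character_mul_form10 g (albertOf10 v)
  rwa [← vecRep_apply, albertTo10_albertOf10] at this

/-- The form is a mixed second difference of the determinant in two directions of the 17-space;
there the term c·Q(v) cancels and the polarized spin part remains. Invariance of determinant values
is therefore enough. -/
theorem spinPairing_spinRep (g : G) (v : Space10 F) (s t : HalfSpin F) :
    spinPairing (clifford (S.vecRep g v) (S.spinRep g s)) (S.spinRep g t) =
      spinPairing (clifford v s) t := by
  have key (X Y Z : Albert F) (hY : albertTo10 Y = 0) (hZ : albertTo10 Z = 0) :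
      albertDet (X + Y + Z) - albertDet (X + Y) - albertDet (X + Z) + albertDet X =
        spinPairing (clifford (albertTo10 X) (albertTo16 Y)) (albertTo16 Z) := by
    simp only [albertDet_eq, map_add, hY, hZ, add_zero, Pi.add_apply, spinCubic_add]
    have e (s s' t : HalfSpin F) : spinPairing (s + s') t = spinPairing s t + spinPairing s' t := by
      simp only [spinPairing, Prod.fst_add, Prod.snd_add, add_octPolar]
      ring
    rw [e]
    ring
  have h := key (S.act g (albertOf10 v)) (S.act g (albertOf16 s)) (S.act g (albertOf16 t))
    (S.albertTo10_act_eq_zero g (albertTo10_albertOf16 s))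
    (S.albertTo10_act_eq_zero g (albertTo10_albertOf16 t))
  rw [← map_add, ← map_add, ← map_add, S.det_act, S.det_act, S.det_act, S.det_act,
    key _ _ _ (albertTo10_albertOf16 s) (albertTo10_albertOf16 t)] at h
  rw [spinRep_apply, spinRep_apply]
  simpa [← vecRep_apply] using h.symm

theorem vecRep_mem_spinLiftable (g : G) : S.vecRep g ∈ spinLiftable F :=
  mem_spinLiftable_iff.mpr ⟨S.spinRep g, 1, fun v s t => by
    rw [S.spinPairing_spinRep, Units.val_one, one_mul]⟩

theorem vecRep_mem_GSO10 (g : G) : S.vecRep g ∈ GSO10 F := by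
  have h (x) : form10 (S.vecRep g x) = ((S.character g)⁻¹ : Fˣ) * form10 x := by
    rw [← S.character_mul_form10_vecRep g x, ← mul_assoc, ← Units.val_mul, inv_mul_cancel,
      Units.val_one, one_mul]
  exact ⟨_, h, det_eq_of_mem_spinLiftable h (S.vecRep_mem_spinLiftable g)⟩

/-- The elements that act by scalars on the 10-dimensional quotient. -/
def scalarKernel : Subgroup G :=
  ((QuotientGroup.mk' (Subgroup.center (Space10 F ≃ₗ[F] Space10 F))).comp S.vecRep).ker

/-- The elements that act by scalars on the 10-dimensional quotient, and trivially on the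
16-dimensional section. -/
def unipotentKernel : Subgroup G := S.scalarKernel ⊓ S.spinRep.ker

instance : S.scalarKernel.Normal := MonoidHom.normal_ker _

instance : S.unipotentKernel.Normal := Subgroup.normal_inf_normal _ _

theorem mem_scalarKernel_iff {g : G} :
    g ∈ S.scalarKernel ↔ ∃ c : Fˣ, ∀ x, S.vecRep g x = (c : F) • x := by
  rw [scalarKernel, MonoidHom.mem_ker, MonoidHom.comp_apply, QuotientGroup.mk'_apply,
    QuotientGroup.eq_one_iff, mem_center_space10_iff]

theorem exists_spinRep_eq_smul {g : G} (hg : g ∈ S.scalarKernel) :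
    ∃ μ : F, ∀ s, S.spinRep g s = μ • s := by
  obtain ⟨c, hc⟩ := S.mem_scalarKernel_iff.mp hg
  obtain ⟨μ, -, h⟩ := exists_eq_smul_of_spinPairing (h := S.spinRep g) (c := ((c⁻¹ : Fˣ) : F))
    (Units.ne_zero _) fun v s t => by
      have := S.spinPairing_spinRep g v s t
      rw [hc, map_smul, LinearMap.smul_apply, smul_spinPairing] at this
      rw [← this, ← mul_assoc, ← Units.val_mul, inv_mul_cancel, Units.val_one, one_mul]
  exact ⟨μ, h⟩

/-- A scalar c on the 10-space multiplies the trilinear form by c when the 16-space is fixed; a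
triple with nonzero value forces c = 1. -/
theorem vecRep_eq_one {g : G} (hg : g ∈ S.unipotentKernel) : S.vecRep g = 1 := by
  obtain ⟨h1, h2⟩ := Subgroup.mem_inf.mp hg
  obtain ⟨c, hc⟩ := S.mem_scalarKernel_iff.mp h1
  have := S.spinPairing_spinRep g (space10Mk 1 0 0) (Pi.single (true, none) 1, 0)
    (Pi.single (false, none) 1, 0)
  rw [MonoidHom.mem_ker.mp h2, hc, map_smul, LinearMap.smul_apply, smul_spinPairing] at this
  rw [linearEquiv_one_apply, linearEquiv_one_apply, spinPairing_clifford_inl, octPolar_single] at this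
  have hc1 : (c : F) = 1 := by simpa using this
  refine LinearEquiv.ext fun x => ?_
  rw [hc, hc1, one_smul, linearEquiv_one_apply]

theorem character_eq_one {g : G} (hg : g ∈ S.unipotentKernel) : (S.character g : F) = 1 := by
  have := S.character_mul_form10_vecRep g (space10Mk 1 1 0)
  rw [S.vecRep_eq_one hg, linearEquiv_one_apply, form10_eq] at this
  simpa [octNorm] using this

theorem act_albertOf16 {g : G} (hg : g ∈ S.unipotentKernel) (s : HalfSpin F) :
    S.act g (albertOf16 s) =
      albertOf16 s + S.act g (albertOf16 s) (Sum.inl 2) • whiteVec F := by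
  have h1 := S.albertTo10_act_eq_zero g (albertTo10_albertOf16 s)
  have h2 : albertTo16 (S.act g (albertOf16 s)) = s := by
    rw [← spinRep_apply, MonoidHom.mem_ker.mp (Subgroup.mem_inf.mp hg).2, linearEquiv_one_apply]
  conv_lhs => rw [albert_decomp (S.act g (albertOf16 s)), h1, h2, map_zero, zero_add]

theorem act_whiteVec_eq_self {g : G} (hg : g ∈ S.unipotentKernel) :
    S.act g (whiteVec F) = whiteVec F := by
  rw [act_whiteVec_eq_character, S.character_eq_one hg, one_smul]

/-- The additive character of the unipotent kernel at a vector of the half spin space. -/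
def unipotentHom : S.unipotentKernel →* Multiplicative (HalfSpin F → F) where
  toFun g := Multiplicative.ofAdd fun s => S.act g (albertOf16 s) (Sum.inl 2)
  map_one' := by
    rw [← ofAdd_zero]
    congr 1
    funext s
    rw [OneMemClass.coe_one, map_one, linearEquiv_one_apply, albertOf16_two, Pi.zero_apply]
  map_mul' g h := by
    rw [← ofAdd_add]
    congr 1
    funext s
    rw [Pi.add_apply, Subgroup.coe_mul, map_mul, LinearEquiv.mul_apply, S.act_albertOf16 h.2,
      map_add, map_smul, S.act_whiteVec_eq_self g.2]
    simp

/-- For nonsingular v the image of v is v + f + wW with f in the 16-space. Comparing determinants at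
v + u for all u gives v·f = 0, so f = 0 by the Clifford relation, and then wQ(v) = 0 gives w = 0.
Nonsingular vectors span the 10-space. -/
theorem eq_one_of_act_albertOf16 {g : G} (hg : g ∈ S.unipotentKernel)
    (h : ∀ s, S.act g (albertOf16 s) = albertOf16 s) : g = 1 := by
  have h10 (v : Space10 F) (hv : form10 v ≠ 0) : S.act g (albertOf10 v) = albertOf10 v := by
    have e0 : albertTo10 (S.act g (albertOf10 v)) = v := by
      rw [← vecRep_apply, S.vecRep_eq_one hg, linearEquiv_one_apply, albertTo10_albertOf10]
    set f := albertTo16 (S.act g (albertOf10 v)) with hf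
    set w := S.act g (albertOf10 v) (Sum.inl 2) with hw
    have e1 (u : HalfSpin F) : w * form10 v + spinCubic v (f + u) = spinCubic v u := by
      have := S.det_act g (albertOf10 v + albertOf16 u)
      rw [map_add, h, albertDet_eq, albertDet_eq] at this
      simpa [e0, ← hf, ← hw] using this
    have e2 : w * form10 v + spinCubic v f = 0 := by
      simpa [spinCubic, octNorm, octMul_zero, zero_octMul, octTrace_zero] using e1 0
    have e3 : clifford v f = 0 := spinPairing_nondegenerate fun u => by
      have := e1 u
      rw [spinCubic_add] at this
      linear_combination this - e2
    have e4 : f = 0 := by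
      have := clifford_spinFlip_clifford v f
      rw [e3, map_zero] at this
      exact (smul_eq_zero.mp this.symm).resolve_left hv
    have e5 : w = 0 := by
      rw [e4] at e2
      have : w * form10 v = 0 := by
        simpa [spinCubic, octNorm, octMul_zero, zero_octMul, octTrace_zero] using e2
      exact (mul_eq_zero.mp this).resolve_right hv
    rw [albert_decomp (S.act g (albertOf10 v)), e0, ← hf, ← hw, e4, e5]
    simp
  have h10' (v : Space10 F) : S.act g (albertOf10 v) = albertOf10 v := by
    have := eq_zero_of_forall_form10_ne_zero
      (L := (S.act g).toLinearMap ∘ₗ albertOf10 - albertOf10) fun v hv => by simp [h10 v hv]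
    simpa [sub_eq_zero] using LinearMap.congr_fun this v
  refine S.injective (LinearEquiv.ext fun X => ?_)
  rw [map_one, linearEquiv_one_apply]
  conv_lhs => rw [albert_decomp X]
  rw [map_add, map_add, map_smul, h, h10', S.act_whiteVec_eq_self hg, ← albert_decomp]

end WhiteAction

end Stabilizer

/-! ### The three layers of the stabilizer and its order -/

section StructureOfStabilizer

theorem exists_injective_quotient_hom {G H : Type*} [Group G] [Group H] (f : G →* H)
    (N : Subgroup G) [N.Normal] (hN : f.ker = N) :
    ∃ γ : G ⧸ N →* H, Function.Injective γ := by
  subst hN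
  exact ⟨QuotientGroup.kerLift f, QuotientGroup.kerLift_injective f⟩

variable {F : Type*} [Field F]

theorem scalar10_mem_spinLiftable (c : Fˣ) :
    (scalar10 c : Space10 F ≃ₗ[F] Space10 F) ∈ spinLiftable F :=
  mem_spinLiftable_iff.mpr ⟨1, c, fun v s t => by
    rw [scalar10_apply, map_smul, LinearMap.smul_apply, smul_spinPairing, linearEquiv_one_apply,
      linearEquiv_one_apply]⟩

namespace WhiteAction

variable {G : Type*} [Group G] (S : WhiteAction F G)

theorem exists_unipotentKernel_hom :
    ∃ α : S.unipotentKernel →* Multiplicative (Fin 16 → F), Function.Injective α := by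
  have hfin : Module.finrank F (HalfSpin F) = 16 := by
    rw [Module.finrank_prod, Module.finrank_fintype_fun_eq_card]
    rfl
  let b := Module.finBasisOfFinrankEq F (HalfSpin F) hfin
  let α : S.unipotentKernel →* Multiplicative (Fin 16 → F) :=
    { toFun := fun g => Multiplicative.ofAdd fun i => (S.unipotentHom g).toAdd (b i)
      map_one' := by rw [map_one]; rfl
      map_mul' := fun g h => by rw [map_mul]; rfl }
  refine ⟨α, (injective_iff_map_eq_one α).mpr fun g hg => ?_⟩
  have hb (i) : S.act g (albertOf16 (b i)) (Sum.inl 2) = 0 := congrFun hg i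
  refine Subtype.ext (S.eq_one_of_act_albertOf16 g.2 fun s => ?_)
  have hs : (LinearMap.proj (Sum.inl 2) ∘ₗ (S.act g).toLinearMap ∘ₗ albertOf16 :
      HalfSpin F →ₗ[F] F) = 0 := b.ext fun i => hb i
  have hs' : S.act g (albertOf16 s) (Sum.inl 2) = 0 := LinearMap.congr_fun hs s
  rw [S.act_albertOf16 g.2, hs', zero_smul, add_zero]

/-- The scalar by which an element of the scalar kernel acts on the half spin space. -/
def spinScalar : S.scalarKernel →* Fˣ :=
  MonoidHom.toHomUnits
    { toFun := fun g => (S.spinRep g (Pi.single (true, none) 1, 0)).1 (true, none)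
      map_one' := by
        rw [OneMemClass.coe_one, map_one, linearEquiv_one_apply]
        exact Pi.single_eq_same (M := fun _ : OctIdx => F) (true, none) 1
      map_mul' := fun g h => by
        obtain ⟨μ, hμ⟩ := S.exists_spinRep_eq_smul g.2
        obtain ⟨ν, hν⟩ := S.exists_spinRep_eq_smul h.2
        rw [Subgroup.coe_mul, map_mul, LinearEquiv.mul_apply, hν, hμ, hμ]
        simp }

theorem spinRep_eq_spinScalar_smul (g : S.scalarKernel) (s : HalfSpin F) :
    S.spinRep g s = (S.spinScalar g : F) • s := by
  obtain ⟨μ, hμ⟩ := S.exists_spinRep_eq_smul g.2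
  have : (S.spinScalar g : F) = (S.spinRep g (Pi.single (true, none) 1, 0)).1 (true, none) := rfl
  rw [this, hμ, hμ]
  simp

theorem ker_spinScalar : S.spinScalar.ker = S.unipotentKernel.subgroupOf S.scalarKernel := by
  ext g
  rw [MonoidHom.mem_ker, Subgroup.mem_subgroupOf, unipotentKernel, Subgroup.mem_inf,
    MonoidHom.mem_ker]
  constructor
  · intro h
    refine ⟨g.2, LinearEquiv.ext fun s => ?_⟩
    rw [spinRep_eq_spinScalar_smul, h, Units.val_one, one_smul, linearEquiv_one_apply]
  · rintro ⟨-, h⟩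
    refine Units.ext ?_
    change (S.spinRep g (Pi.single (true, none) 1, 0)).1 (true, none) = 1
    rw [h, linearEquiv_one_apply]
    exact Pi.single_eq_same (M := fun _ : OctIdx => F) (true, none) 1

theorem exists_scalarKernel_hom [Finite F] :
    ∃ β : (S.scalarKernel ⧸ S.unipotentKernel.subgroupOf S.scalarKernel) →*
      Multiplicative (ZMod (Nat.card F - 1)), Function.Injective β := by
  obtain ⟨e⟩ : Nonempty (Fˣ ≃* Multiplicative (ZMod (Nat.card F - 1))) := by
    rw [← Nat.card_units]
    exact ⟨(zmodCyclicMulEquiv inferInstance).symm⟩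
  obtain ⟨β, hβ⟩ := exists_injective_quotient_hom S.spinScalar _ S.ker_spinScalar
  exact ⟨e.toMonoidHom.comp β, e.injective.comp hβ⟩

theorem exists_quotient_hom_PGSO10 :
    ∃ γ : G ⧸ S.scalarKernel →* PGSO10 F, Function.Injective γ :=
  exists_injective_quotient_hom
    (((QuotientGroup.mk' (Subgroup.center (Space10 F ≃ₗ[F] Space10 F))).comp
      S.vecRep).codRestrict (PGSO10 F) fun g =>
        Subgroup.mem_map_of_mem _ (S.vecRep_mem_GSO10 g)) _ (MonoidHom.ker_codRestrict _ _ _)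

/-- The multiplier of the 10-dimensional action is the inverse of the character. Rescaling by the
square root of the character turns the action into a homomorphism to isometries; these still lift to
the half spin space, hence lie in Ω. -/
theorem exists_quotient_hom_SO10 [Finite F] (h2 : ringChar F = 2) :
    ∃ γ : G ⧸ S.scalarKernel →* SO10 F, Function.Injective γ := by
  have := Fintype.ofFinite F
  have hchar : CharP F 2 := h2 ▸ ringChar.charP F
  -- With n = q/2, the map c ↦ c^n is a multiplicative square root, because c^q = c.
  obtain ⟨n, hn⟩ : ∃ n, Fintype.card F = n * 2 :=
    ⟨Fintype.card F / 2, (Nat.div_mul_cancel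
      (Nat.dvd_of_mod_eq_zero (FiniteField.even_card_iff_char_two.mp h2))).symm⟩
  have sqrt (c : Fˣ) : ((c ^ n : Fˣ) : F) ^ 2 = c := by
    rw [Units.val_pow_eq_pow_val, ← pow_mul, ← hn, FiniteField.pow_card]
  let f : G →* (Space10 F ≃ₗ[F] Space10 F) :=
    { toFun := fun g => scalar10 (S.character g ^ n) * S.vecRep g
      map_one' := by
        refine LinearEquiv.ext fun x => ?_
        rw [map_one, map_one, one_pow, mul_one, scalar10_apply, Units.val_one, one_smul,
          linearEquiv_one_apply]
      map_mul' := fun g h => by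
        refine LinearEquiv.ext fun x => ?_
        simp only [map_mul, LinearEquiv.mul_apply, scalar10_apply, map_smul, smul_smul, mul_pow,
          Units.val_mul]
        rw [mul_comm] }
  have hf (g x) : f g x = ((S.character g ^ n : Fˣ) : F) • S.vecRep g x := rfl
  have hO (g) : f g ∈ O10 F := fun x => by
    rw [hf, form10_smul, sqrt, S.character_mul_form10_vecRep]
  have hmem (g) : f g ∈ SO10 F := by
    rw [SO10_eq_of_ringChar_eq_two h2]
    exact mem_evenReflectionGroup10 (hO g)
      (mul_mem (scalar10_mem_spinLiftable _) (S.vecRep_mem_spinLiftable g))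
  refine exists_injective_quotient_hom (f.codRestrict _ hmem) _ ?_
  rw [MonoidHom.ker_codRestrict]
  ext g
  rw [MonoidHom.mem_ker, mem_scalarKernel_iff]
  constructor
  · intro h
    refine ⟨(S.character g ^ n)⁻¹, fun x => ?_⟩
    have hx := hf g x
    rw [h, linearEquiv_one_apply] at hx
    conv_rhs => rw [hx]
    rw [smul_smul, ← Units.val_mul, inv_mul_cancel, Units.val_one, one_smul]
  · rintro ⟨c, hc⟩
    have hx (x) : f g x = (((S.character g ^ n : Fˣ) : F) * c) • x := by rw [hf, hc, smul_smul]
    -- A scalar isometry has square 1, hence is trivial in characteristic 2; so the rescaling does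
    -- not change the kernel modulo scalars.
    have h1 : (((S.character g ^ n : Fˣ) : F) * c) ^ 2 = 1 ^ 2 := by
      have := hO g (space10Mk 1 1 0)
      rw [hx, form10_smul, form10_eq] at this
      simpa [octNorm] using this
    refine LinearEquiv.ext fun x => ?_
    rw [hx, CharTwo.sq_injective h1, one_smul, linearEquiv_one_apply]

theorem structure_of_stabilizer [Finite F] (S : WhiteAction F G) :
    (∃ (N₁ N₂ : Subgroup G) (_ : N₁.Normal) (_ : N₂.Normal),
      N₁ ≤ N₂ ∧
      (∃ α : N₁ →* Multiplicative (Fin 16 → F), Function.Injective α) ∧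
      (∃ β : (N₂ ⧸ N₁.subgroupOf N₂) →* Multiplicative (ZMod (Nat.card F - 1)),
        Function.Injective β) ∧
      Nat.card (G ⧸ N₂) ≤ Nat.card (SO10 F) ∧
      (ringChar F = 2 → ∃ γ : (G ⧸ N₂) →* SO10 F, Function.Injective γ) ∧
      (ringChar F ≠ 2 → ∃ γ : (G ⧸ N₂) →* PGSO10 F, Function.Injective γ)) ∧
    Nat.card G ≤ Nat.card F ^ 16 * (Nat.card F - 1) * Nat.card (SO10 F) := by
  have : Finite (Space10 F ≃ₗ[F] Space10 F) := Finite.of_injective _ DFunLike.coe_injective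
  obtain ⟨α, hα⟩ := S.exists_unipotentKernel_hom
  obtain ⟨β, hβ⟩ := S.exists_scalarKernel_hom
  have hcard : Nat.card (G ⧸ S.scalarKernel) ≤ Nat.card (SO10 F) := by
    by_cases h : ringChar F = 2
    · obtain ⟨γ, hγ⟩ := S.exists_quotient_hom_SO10 h
      exact Nat.card_le_card_of_injective γ hγ
    · obtain ⟨γ, hγ⟩ := S.exists_quotient_hom_PGSO10
      exact (Nat.card_le_card_of_injective γ hγ).trans (card_PGSO10_le h)
  have hle : S.unipotentKernel ≤ S.scalarKernel := inf_le_left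
  have hq : 0 < Nat.card F - 1 := Nat.sub_pos_of_lt Finite.one_lt_card
  -- The cyclic group is modelled by `ZMod (q - 1)`, which is finite only because q - 1 ≠ 0;
  -- otherwise its `Nat.card` would bound nothing.
  have : NeZero (Nat.card F - 1) := ⟨hq.ne'⟩
  refine ⟨⟨S.unipotentKernel, S.scalarKernel, inferInstance, inferInstance, hle, ⟨α, hα⟩, ⟨β, hβ⟩,
    hcard, fun h => S.exists_quotient_hom_SO10 h, fun _ => S.exists_quotient_hom_PGSO10⟩, ?_⟩
  have h1 : Nat.card S.unipotentKernel ≤ Nat.card F ^ 16 := by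
    refine (Nat.card_le_card_of_injective α hα).trans_eq ?_
    rw [Nat.card_congr Multiplicative.toAdd, Nat.card_fun, Nat.card_fin]
  have h2 : Nat.card (S.scalarKernel ⧸ S.unipotentKernel.subgroupOf S.scalarKernel) ≤
      Nat.card F - 1 := by
    refine (Nat.card_le_card_of_injective β hβ).trans_eq ?_
    rw [Nat.card_congr Multiplicative.toAdd, Nat.card_zmod]
  rw [Subgroup.card_eq_card_quotient_mul_card_subgroup S.scalarKernel,
    Subgroup.card_eq_card_quotient_mul_card_subgroup
      (S.unipotentKernel.subgroupOf S.scalarKernel),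
    Nat.card_congr (Subgroup.subgroupOfEquivOfLe hle).toEquiv, mul_comm,
    mul_comm (Nat.card (S.scalarKernel ⧸ _))]
  exact Nat.mul_le_mul (Nat.mul_le_mul h1 h2) hcard

end WhiteAction

end StructureOfStabilizer

/-! ### Transitivity on white points -/

section Transitivity

/-! ### The adjoint and explicit isometries over an arbitrary commutative ring -/

section Ring

variable {R S : Type*} [CommRing R] [CommRing S]

/-- The adjoint of an element of the Albert algebra. -/
def albertSharp (X : Albert R) : Albert R :=
  albertMk (X (Sum.inl 1) * X (Sum.inl 2) - octNorm (albertOff X 0))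
    (X (Sum.inl 2) * X (Sum.inl 0) - octNorm (albertOff X 1))
    (X (Sum.inl 0) * X (Sum.inl 1) - octNorm (albertOff X 2))
    (octConj (octMul (albertOff X 1) (albertOff X 2)) - X (Sum.inl 0) • albertOff X 0)
    (octConj (octMul (albertOff X 2) (albertOff X 0)) - X (Sum.inl 1) • albertOff X 1)
    (octConj (octMul (albertOff X 0) (albertOff X 1)) - X (Sum.inl 2) • albertOff X 2)

/-- The trace form of the Albert algebra. -/
def albertPairing (X Y : Albert R) : R :=
  X (Sum.inl 0) * Y (Sum.inl 0) + X (Sum.inl 1) * Y (Sum.inl 1) + X (Sum.inl 2) * Y (Sum.inl 2) +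
    octPolar (albertOff X 0) (albertOff Y 0) + octPolar (albertOff X 1) (albertOff Y 1) +
    octPolar (albertOff X 2) (albertOff Y 2)

theorem albertPairing_nondegenerate {X : Albert R} (h : ∀ Y, albertPairing X Y = 0) : X = 0 := by
  have hz : albertOff (0 : Albert R) = 0 := rfl
  refine albert_ext (fun n => ?_) ?_ ?_ ?_
  · fin_cases n
    · simpa [albertPairing, octPolar_zero] using h (albertMk 1 0 0 0 0 0)
    · simpa [albertPairing, octPolar_zero] using h (albertMk 0 1 0 0 0 0)
    · simpa [albertPairing, octPolar_zero] using h (albertMk 0 0 1 0 0 0)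
  · exact octPolar_nondegenerate fun y => by
      simpa [albertPairing, octPolar_zero] using h (albertMk 0 0 0 y 0 0)
  · exact octPolar_nondegenerate fun y => by
      simpa [albertPairing, octPolar_zero] using h (albertMk 0 0 0 0 y 0)
  · exact octPolar_nondegenerate fun y => by
      simpa [albertPairing, octPolar_zero] using h (albertMk 0 0 0 0 0 y)

/-- The term linear in t exhibits the adjoint as the gradient of the determinant. It is needed over
the dual numbers as well as over the field. -/
theorem albertDet_add_smul (t : R) (X Y : Albert R) : albertDet (X + t • Y) =
    albertDet X + t * albertPairing (albertSharp X) Y +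
      t ^ 2 * albertPairing (albertSharp Y) X + t ^ 3 * albertDet Y := by
  have h (n : Fin 3) : albertOff (X + t • Y) n = albertOff X n + t • albertOff Y n := rfl
  simp only [albertDet, albertDiag, albertPairing, albertSharp, h, albertMk_zero, albertMk_one,
    albertMk_two, albertOff_albertMk_zero, albertOff_albertMk_one, albertOff_albertMk_two,
    Pi.add_apply, Pi.smul_apply, smul_eq_mul]
  generalize albertOff X 0 = A
  generalize albertOff X 1 = B
  generalize albertOff X 2 = C
  generalize albertOff Y 0 = A'
  generalize albertOff Y 1 = B'
  generalize albertOff Y 2 = C'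
  simp only [octNorm_eq, octPolar_eq, octTrace, octMul_true_none, octMul_false_none,
    octMul_true_zero, octMul_true_one, octMul_true_two, octMul_false_zero, octMul_false_one,
    octMul_false_two, Pi.add_apply, Pi.sub_apply, Pi.smul_apply, smul_eq_mul, octConj_none,
    octConj_some, Bool.not_true, Bool.not_false]
  ring

theorem octConj_map (f : R →+* S) (x : SplitOct R) :
    octConj (fun i => f (x i)) = fun i => f (octConj x i) := by
  funext ⟨s, k⟩
  rcases k with _ | k
  · rfl
  · exact (map_neg f _).symm

theorem octNorm_map (f : R →+* S) (x : SplitOct R) : octNorm (fun i => f (x i)) = f (octNorm x) := by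
  simp [octNorm]

theorem octPolar_map (f : R →+* S) (x y : SplitOct R) :
    octPolar (fun i => f (x i)) (fun i => f (y i)) = f (octPolar x y) := by
  simp [octPolar]

theorem albertMk_map (f : R →+* S) (a b c : R) (A B C : SplitOct R) :
    (fun i => f (albertMk a b c A B C i)) =
      albertMk (f a) (f b) (f c) (fun i => f (A i)) (fun i => f (B i)) (fun i => f (C i)) := by
  refine albert_ext (fun n => ?_) rfl rfl rfl
  fin_cases n <;> rfl

theorem albertOff_map (f : R →+* S) (X : Albert R) (n : Fin 3) :
    albertOff (fun i => f (X i)) n = fun i => f (albertOff X n i) := rfl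

/-- The transvection that adds multiples of the third row and column to the second ones. -/
def albertTransvection (x : SplitOct R) : Albert R →ₗ[R] Albert R where
  toFun X := albertMk (X (Sum.inl 0))
    (X (Sum.inl 1) + octPolar (albertOff X 0) x + X (Sum.inl 2) * octNorm x) (X (Sum.inl 2))
    (albertOff X 0 + X (Sum.inl 2) • x) (albertOff X 1)
    (albertOff X 2 + octConj (octMul x (albertOff X 1)))
  map_add' X Y := by
    refine albert_ext (fun n => ?_) ?_ rfl ?_
    · fin_cases n
      · rfl
      · change X (Sum.inl 1) + Y (Sum.inl 1) + octPolar (albertOff X 0 + albertOff Y 0) x +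
          (X (Sum.inl 2) + Y (Sum.inl 2)) * octNorm x =
          X (Sum.inl 1) + octPolar (albertOff X 0) x + X (Sum.inl 2) * octNorm x +
          (Y (Sum.inl 1) + octPolar (albertOff Y 0) x + Y (Sum.inl 2) * octNorm x)
        rw [add_octPolar]
        ring
      · rfl
    · change albertOff X 0 + albertOff Y 0 + (X (Sum.inl 2) + Y (Sum.inl 2)) • x =
        albertOff X 0 + X (Sum.inl 2) • x + (albertOff Y 0 + Y (Sum.inl 2) • x)
      module
    · change albertOff X 2 + albertOff Y 2 + octConj (octMul x (albertOff X 1 + albertOff Y 1)) =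
        albertOff X 2 + octConj (octMul x (albertOff X 1)) +
        (albertOff Y 2 + octConj (octMul x (albertOff Y 1)))
      rw [octMul_add, octConj_add]
      abel
  map_smul' c X := by
    refine albert_ext (fun n => ?_) ?_ rfl ?_
    · fin_cases n
      · rfl
      · change c * X (Sum.inl 1) + octPolar (c • albertOff X 0) x +
          c * X (Sum.inl 2) * octNorm x =
          c * (X (Sum.inl 1) + octPolar (albertOff X 0) x + X (Sum.inl 2) * octNorm x)
        rw [smul_octPolar]
        ring
      · rfl
    · change c • albertOff X 0 + (c * X (Sum.inl 2)) • x =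
        c • (albertOff X 0 + X (Sum.inl 2) • x)
      module
    · change c • albertOff X 2 + octConj (octMul x (c • albertOff X 1)) =
        c • (albertOff X 2 + octConj (octMul x (albertOff X 1)))
      rw [octMul_smul, octConj_smul, smul_add]

theorem albertTransvection_apply (x : SplitOct R) (X : Albert R) : albertTransvection x X =
    albertMk (X (Sum.inl 0))
      (X (Sum.inl 1) + octPolar (albertOff X 0) x + X (Sum.inl 2) * octNorm x) (X (Sum.inl 2))
      (albertOff X 0 + X (Sum.inl 2) • x) (albertOff X 1)
      (albertOff X 2 + octConj (octMul x (albertOff X 1))) := rfl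

/-- The isometry of the determinant that reverses the order of products. -/
def albertSwap : Albert R →ₗ[R] Albert R where
  toFun X := albertMk (X (Sum.inl 1)) (X (Sum.inl 0)) (X (Sum.inl 2))
    (octConj (albertOff X 1)) (octConj (albertOff X 0)) (octConj (albertOff X 2))
  map_add' X Y := by
    refine albert_ext (fun n => ?_)
      (octConj_add (albertOff X 1) (albertOff Y 1))
      (octConj_add (albertOff X 0) (albertOff Y 0))
      (octConj_add (albertOff X 2) (albertOff Y 2))
    fin_cases n <;> rfl
  map_smul' c X := by
    refine albert_ext (fun n => ?_)
      (octConj_smul c (albertOff X 1))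
      (octConj_smul c (albertOff X 0))
      (octConj_smul c (albertOff X 2))
    fin_cases n <;> rfl

/-- The cyclic permutation of the coordinates. -/
def albertCycle : Albert R →ₗ[R] Albert R where
  toFun X := albertMk (X (Sum.inl 1)) (X (Sum.inl 2)) (X (Sum.inl 0))
    (albertOff X 1) (albertOff X 2) (albertOff X 0)
  map_add' X Y := by
    refine albert_ext (fun n => ?_) rfl rfl rfl
    fin_cases n <;> rfl
  map_smul' c X := by
    refine albert_ext (fun n => ?_) rfl rfl rfl
    fin_cases n <;> rfl

theorem albertSwap_apply (X : Albert R) : albertSwap X =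
    albertMk (X (Sum.inl 1)) (X (Sum.inl 0)) (X (Sum.inl 2))
      (octConj (albertOff X 1)) (octConj (albertOff X 0)) (octConj (albertOff X 2)) := rfl

theorem albertCycle_apply (X : Albert R) : albertCycle X =
    albertMk (X (Sum.inl 1)) (X (Sum.inl 2)) (X (Sum.inl 0))
      (albertOff X 1) (albertOff X 2) (albertOff X 0) := rfl

theorem albertDet_albertTransvection (x : SplitOct R) (X : Albert R) :
    albertDet (albertTransvection x X) = albertDet X := by
  simp only [albertTransvection_apply, albertDet, albertDiag, albertMk_zero, albertMk_one,
    albertMk_two, albertOff_albertMk_zero, albertOff_albertMk_one, albertOff_albertMk_two]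
  generalize albertOff X 0 = A
  generalize albertOff X 1 = B
  generalize albertOff X 2 = C
  simp only [octNorm_eq, octPolar_eq, octTrace, octMul_true_none, octMul_false_none,
    octMul_true_zero, octMul_true_one, octMul_true_two, octMul_false_zero, octMul_false_one,
    octMul_false_two, Pi.add_apply, Pi.smul_apply, smul_eq_mul, octConj_none,
    octConj_some, Bool.not_true, Bool.not_false]
  ring

theorem albertDet_albertSwap (X : Albert R) : albertDet (albertSwap X) = albertDet X := by
  have h (x y z : SplitOct R) : octTrace (octMul (octMul (octConj y) (octConj x)) (octConj z)) =
      octTrace (octMul (octMul x y) z) := by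
    simp [octTrace]
    ring
  simp only [albertSwap_apply, albertDet, albertDiag, albertMk_zero, albertMk_one,
    albertMk_two, albertOff_albertMk_zero, albertOff_albertMk_one, albertOff_albertMk_two,
    octNorm_octConj, h]
  ring

theorem albertDet_albertCycle (X : Albert R) : albertDet (albertCycle X) = albertDet X := by
  simp only [albertCycle_apply, albertDet, albertDiag, albertMk_zero, albertMk_one,
    albertMk_two, albertOff_albertMk_zero, albertOff_albertMk_one, albertOff_albertMk_two,
    octTrace_octMul_cycle (albertOff X 0)]
  ring

theorem albertTransvection_neg_apply (x : SplitOct R) (X : Albert R) :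
    albertTransvection (-x) (albertTransvection x X) = X := by
  have hp (y z : SplitOct R) : octPolar y (-z) = -octPolar y z := by
    simp [octPolar_eq]
    ring
  have hN : octNorm (-x) = octNorm x := by simp [octNorm_eq]
  have hs : octPolar x x = 2 * octNorm x := by
    simp [octPolar_eq, octNorm_eq]
    ring
  rw [albertTransvection_apply, albertTransvection_apply]
  refine albert_ext (fun n => ?_) ?_ rfl ?_
  · fin_cases n
    · rfl
    · simp only [albertMk_one, albertMk_two, albertOff_albertMk_zero, hp, hN, add_octPolar,
        smul_octPolar, hs, Fin.mk_one]
      ring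
    · rfl
  · simp
  · simp only [albertOff_albertMk_one, albertOff_albertMk_two, neg_octMul, octConj_neg]
    abel

theorem albertTransvection_map (f : R →+* S) (x : SplitOct R) (X : Albert R) :
    albertTransvection (fun i => f (x i)) (fun i => f (X i)) =
      fun i => f (albertTransvection x X i) := by
  simp only [albertTransvection_apply, albertMk_map, albertOff_map, octPolar_map, octNorm_map,
    octMul_map, octConj_map, map_add, map_mul]
  refine albert_ext (fun n => ?_) ?_ rfl ?_
  · fin_cases n <;> rfl
  all_goals
    funext i
    simp

theorem albertSwap_map (f : R →+* S) (X : Albert R) :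
    albertSwap (fun i => f (X i)) = fun i => f (albertSwap X i) := by
  simp only [albertSwap_apply, albertMk_map, albertOff_map, octConj_map]

theorem albertCycle_map (f : R →+* S) (X : Albert R) :
    albertCycle (fun i => f (X i)) = fun i => f (albertCycle X i) := by
  simp only [albertCycle_apply, albertMk_map, albertOff_map]

end Ring

/-! ### Extension of scalars, infinitesimal invariance and the orbit of the standard white vector -/

section Group

variable {F A : Type*} [Field F] [CommRing A] [Algebra F A]

theorem albertExtend_eq {g : Albert F ≃ₗ[F] Albert F} (φ : Albert A →ₗ[A] Albert A)
    (h : ∀ w : Albert F, φ (fun i => algebraMap F A (w i)) = fun i => algebraMap F A (g w i))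
    (v : Albert A) : albertExtend g v = φ v := by
  conv_rhs => rw [← Finset.univ_sum_single v]
  rw [map_sum]
  funext i
  rw [Finset.sum_apply, albertExtend]
  refine Finset.sum_congr rfl fun j _ => ?_
  have h1 : (Pi.single j (v j) : Albert A) = v j • Pi.single j 1 := by
    rw [← Pi.single_smul]
    simp
  have h2 : (Pi.single j 1 : Albert A) =
      fun i => algebraMap F A ((Pi.single j 1 : Albert F) i) := by
    funext i
    by_cases hij : i = j
    · subst hij
      simp
    · simp [hij]
  rw [h1, map_smul, h2, h, Pi.smul_apply, smul_eq_mul, mul_comm]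

theorem albertExtend_algebraMap (g : Albert F ≃ₗ[F] Albert F) (w : Albert F) :
    albertExtend g (fun i => algebraMap F A (w i)) = fun i => algebraMap F A (g w i) := by
  funext i
  simp only [albertExtend, ← map_mul, ← map_sum]
  congr 1
  conv_rhs => rw [← Finset.univ_sum_single w]
  rw [map_sum, Finset.sum_apply]
  refine Finset.sum_congr rfl fun j _ => ?_
  have : (Pi.single j (w j) : Albert F) = w j • Pi.single j 1 := by
    rw [← Pi.single_smul]
    simp
  rw [this, map_smul, Pi.smul_apply, smul_eq_mul, mul_comm]

theorem albertExtend_add_smul (g : Albert F ≃ₗ[F] Albert F) (t : A) (v w : Albert A) :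
    albertExtend g (v + t • w) = albertExtend g v + t • albertExtend g w := by
  funext i
  simp only [albertExtend, Pi.add_apply, Pi.smul_apply, smul_eq_mul, Finset.mul_sum, mul_add,
    Finset.sum_add_distrib]
  congr 1
  exact Finset.sum_congr rfl fun j _ => by ring

theorem albertDet_of_mem_SE6 {g : Albert F ≃ₗ[F] Albert F} (hg : g ∈ SE6 F) (X : Albert F) :
    albertDet (g X) = albertDet X := by
  have h : PreservesDet g := hg
  have := h.extend (A := F) X
  rwa [show albertExtend g X = g X from albertExtend_algebraMap (A := F) g X] at this

/-- Over a small finite field, preserving the values of the cubic form is weaker than preserving the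
form. The identity is therefore checked over the polynomial ring, where each explicit isometry is
given by the same formula. -/
theorem mem_SE6_of_extension {g : Albert F ≃ₗ[F] Albert F}
    (φ : Albert (MvPolynomial AlbertIdx F) →ₗ[MvPolynomial AlbertIdx F]
      Albert (MvPolynomial AlbertIdx F))
    (h : ∀ w : Albert F, φ (fun i => algebraMap F _ (w i)) = fun i => algebraMap F _ (g w i))
    (hdet : ∀ X, albertDet (φ X) = albertDet X) : g ∈ SE6 F := by
  change PreservesDet g
  rw [PreservesDet, albertExtend_eq φ h, hdet]

/-- The transvection as an element of the group. -/
def transvectionEquiv (x : SplitOct F) : Albert F ≃ₗ[F] Albert F :=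
  LinearEquiv.ofLinearMap (albertTransvection x) (albertTransvection (-x))
    (LinearMap.ext fun X => by
      simpa using albertTransvection_neg_apply (-x) X)
    (LinearMap.ext fun X => albertTransvection_neg_apply x X)

theorem transvectionEquiv_mem (x : SplitOct F) : transvectionEquiv x ∈ SE6 F :=
  mem_SE6_of_extension (albertTransvection fun i => algebraMap F _ (x i))
    (albertTransvection_map _ x) (albertDet_albertTransvection _)

/-- The order reversing isometry as an element of the group. -/
def swapEquiv (F : Type*) [Field F] : Albert F ≃ₗ[F] Albert F :=
  LinearEquiv.ofInvolutive albertSwap fun X => by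
    simp only [albertSwap_apply, albertMk_zero, albertMk_one, albertMk_two,
      albertOff_albertMk_zero, albertOff_albertMk_one, albertOff_albertMk_two, octConj_octConj,
      albertMk_eq]

theorem swapEquiv_mem : swapEquiv F ∈ SE6 F :=
  mem_SE6_of_extension albertSwap (albertSwap_map _) albertDet_albertSwap

/-- The cyclic permutation as an element of the group. -/
def cycleEquiv (F : Type*) [Field F] : Albert F ≃ₗ[F] Albert F :=
  LinearEquiv.ofLinearMap albertCycle (albertCycle ∘ₗ albertCycle)
    (LinearMap.ext fun X => albertMk_eq X) (LinearMap.ext fun X => albertMk_eq X)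

theorem cycleEquiv_mem : cycleEquiv F ∈ SE6 F :=
  mem_SE6_of_extension albertCycle (albertCycle_map _) albertDet_albertCycle

theorem albertSharp_map {R S : Type*} [CommRing R] [CommRing S] (f : R →+* S) (X : Albert R) :
    albertSharp (fun i => f (X i)) = fun i => f (albertSharp X i) := by
  simp only [albertSharp, albertMk_map, albertOff_map, octNorm_map, octMul_map, octConj_map,
    map_sub, map_mul]
  refine albert_ext (fun n => ?_) ?_ ?_ ?_
  · fin_cases n <;> rfl
  all_goals
    funext i
    simp

theorem albertPairing_map {R S : Type*} [CommRing R] [CommRing S] (f : R →+* S)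
    (X Y : Albert R) :
    albertPairing (fun i => f (X i)) (fun i => f (Y i)) = f (albertPairing X Y) := by
  simp only [albertPairing, albertOff_map, octPolar_map, map_add, map_mul]

/-- The directional derivative of the determinant, as the infinitesimal part of its value over
the dual numbers. -/
theorem snd_albertDet (X Y : Albert F) :
    TrivSqZeroExt.snd (albertDet ((fun i => algebraMap F (DualNumber F) (X i)) +
      (DualNumber.eps : DualNumber F) • fun i => algebraMap F (DualNumber F) (Y i))) =
      albertPairing (albertSharp X) Y := by
  rw [albertDet_add_smul, albertDet_map, albertSharp_map, albertPairing_map, sq, pow_succ, sq,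
    DualNumber.eps_mul_eps]
  simp [TrivSqZeroExt.algebraMap_eq_inl]

/-- The derivative of det(gX + t·gY) = det(X + tY), obtained by putting t = ε over the dual numbers.
-/
theorem albertPairing_albertSharp_of_mem_SE6 {g : Albert F ≃ₗ[F] Albert F} (hg : g ∈ SE6 F)
    (X Y : Albert F) :
    albertPairing (albertSharp (g X)) (g Y) = albertPairing (albertSharp X) Y := by
  have h : PreservesDet g := hg
  rw [← snd_albertDet, ← snd_albertDet, ← albertExtend_algebraMap, ← albertExtend_algebraMap,
    ← albertExtend_add_smul, h.extend]

theorem albertSharp_eq_zero_of_mem_SE6 {g : Albert F ≃ₗ[F] Albert F} (hg : g ∈ SE6 F)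
    {X : Albert F} (hX : albertSharp X = 0) : albertSharp (g X) = 0 := by
  refine albertPairing_nondegenerate fun Y => ?_
  obtain ⟨Y, rfl⟩ := g.surjective Y
  rw [albertPairing_albertSharp_of_mem_SE6 hg, hX]
  have h (n : Fin 3) : albertOff (0 : Albert F) n = 0 := rfl
  simp [albertPairing, h, zero_octPolar]

/-- At a multiple of ε, terms of degree at least 2 vanish since ε² = 0, the constant term has no
infinitesimal part, and the linear term is zero by hypothesis. This turns formal whiteness into a
vanishing gradient. -/
theorem snd_aeval_eps_smul {σ : Type*} (p : MvPolynomial σ F)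
    (hp : MvPolynomial.homogeneousComponent 1 p = 0) (y : σ → DualNumber F) :
    TrivSqZeroExt.snd (MvPolynomial.aeval ((DualNumber.eps : DualNumber F) • y) p) = 0 := by
  rw [MvPolynomial.aeval_def, MvPolynomial.eval₂_eq, TrivSqZeroExt.snd_sum]
  refine Finset.sum_eq_zero fun d _ => ?_
  have h1 : ∏ i ∈ d.support, ((DualNumber.eps : DualNumber F) • y) i ^ d i =
      DualNumber.eps ^ d.degree * ∏ i ∈ d.support, y i ^ d i := by
    simp only [Pi.smul_apply, smul_eq_mul, mul_pow, Finset.prod_mul_distrib,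
      Finset.prod_pow_eq_pow_sum, Finsupp.degree]
    rfl
  rw [h1]
  rcases hd : d.degree with _ | _ | n
  · rw [Finsupp.degree_eq_zero_iff] at hd
    subst hd
    simp [TrivSqZeroExt.algebraMap_eq_inl]
  · have := congrArg (MvPolynomial.coeff d) hp
    rw [MvPolynomial.coeff_homogeneousComponent, if_pos hd, MvPolynomial.coeff_zero] at this
    rw [this]
    simp
  · rw [pow_succ, pow_succ, mul_assoc (_ ^ n), DualNumber.eps_mul_eps]
    simp

theorem IsWhite.albertSharp_eq_zero {W : Albert F} (hW : IsWhite W) : albertSharp W = 0 := by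
  refine albertPairing_nondegenerate fun Y => ?_
  rw [← snd_albertDet, ← snd_aeval_eps_smul _ hW.2 fun i => algebraMap F (DualNumber F) (Y i)]
  congr 1
  have h := albertDet_map (MvPolynomial.aeval ((DualNumber.eps : DualNumber F) •
    fun i => algebraMap F (DualNumber F) (Y i))).toRingHom
    fun i => MvPolynomial.C (W i) + (MvPolynomial.X i : MvPolynomial AlbertIdx F)
  simp only [AlgHom.toRingHom_eq_coe, RingHom.coe_coe] at h
  rw [← h]
  congr 1
  funext i
  simp

/-- `W` spans the image of the standard white point under an element of the group. -/
def IsStandardWhite (W : Albert F) : Prop :=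
  ∃ g ∈ SE6 F, ∃ c : F, c ≠ 0 ∧ g (whiteVec F) = c • W

theorem IsStandardWhite.of_map {g : Albert F ≃ₗ[F] Albert F} (hg : g ∈ SE6 F) {W : Albert F}
    (h : IsStandardWhite (g W)) : IsStandardWhite W := by
  obtain ⟨h, hh, c, hc, e⟩ := h
  refine ⟨g⁻¹ * h, mul_mem (inv_mem hg) hh, c, hc, ?_⟩
  rw [LinearEquiv.mul_apply, e, map_smul]
  exact congrArg _ (g.symm_apply_apply W)

/-- With c ≠ 0, a vanishing adjoint gives a = N(B)/c, b = N(A)/c and C as the conjugate of AB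
divided by c. So W is determined by c, A, B. -/
theorem isStandardWhite_of_two_ne_zero {W : Albert F} (hW : albertSharp W = 0)
    (h2 : W (Sum.inl 2) ≠ 0) : IsStandardWhite W := by
  have e0 : W (Sum.inl 1) * W (Sum.inl 2) = octNorm (albertOff W 0) :=
    sub_eq_zero.mp (congrFun hW (Sum.inl 0))
  have e1 : W (Sum.inl 2) * W (Sum.inl 0) = octNorm (albertOff W 1) :=
    sub_eq_zero.mp (congrFun hW (Sum.inl 1))
  have e2 : octConj (octMul (albertOff W 0) (albertOff W 1)) =
      W (Sum.inl 2) • albertOff W 2 := by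
    have := congrArg (fun X => albertOff X 2) hW
    exact sub_eq_zero.mp this
  set c := W (Sum.inl 2) with hc
  -- The first transvection followed by the swap creates the entry B/c, together with a; the second
  -- transvection creates A/c, together with b and C. The result is W divided by c.
  refine ⟨transvectionEquiv (c⁻¹ • albertOff W 0) * (swapEquiv F *
    transvectionEquiv (c⁻¹ • octConj (albertOff W 1))),
    mul_mem (transvectionEquiv_mem _) (mul_mem swapEquiv_mem (transvectionEquiv_mem _)),
    c⁻¹, inv_ne_zero h2, ?_⟩
  have h1 : transvectionEquiv (c⁻¹ • octConj (albertOff W 1)) (whiteVec F) =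
      albertMk 0 (octNorm (c⁻¹ • octConj (albertOff W 1))) 1
        (c⁻¹ • octConj (albertOff W 1)) 0 0 := by
    change albertTransvection _ (albertMk 0 0 1 0 0 0) = _
    rw [albertTransvection_apply]
    simp [zero_octPolar, octMul_zero, octConj_zero]
  have h3 (X) : swapEquiv F X = albertSwap X := rfl
  have h4 (x X) : transvectionEquiv (F := F) x X = albertTransvection x X := rfl
  rw [LinearEquiv.mul_apply, LinearEquiv.mul_apply, h1, h3, h4, albertSwap_apply,
    albertTransvection_apply]
  simp only [albertMk_zero, albertMk_one, albertMk_two,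
    albertOff_albertMk_zero, albertOff_albertMk_one, albertOff_albertMk_two, octConj_smul,
    octConj_octConj, octConj_zero, zero_octPolar, zero_add, one_mul, one_smul, octNorm_smul,
    octNorm_octConj, octMul_smul, smul_octMul, e2]
  rw [← e0, ← e1]
  refine albert_ext (fun n => ?_) rfl rfl ?_
  · fin_cases n
    · simp
      field_simp
    · simp
      field_simp
    · simp [← hc, h2]
  · simp [smul_smul, h2]

theorem isStandardWhite_of_diag_ne_zero {W : Albert F} (hW : albertSharp W = 0)
    (h : ∃ n, W (Sum.inl n) ≠ 0) : IsStandardWhite W := by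
  have hcyc := albertSharp_eq_zero_of_mem_SE6 cycleEquiv_mem hW
  obtain ⟨n, hn⟩ := h
  fin_cases n
  · exact .of_map cycleEquiv_mem (isStandardWhite_of_two_ne_zero hcyc hn)
  · exact .of_map cycleEquiv_mem (.of_map cycleEquiv_mem
      (isStandardWhite_of_two_ne_zero (albertSharp_eq_zero_of_mem_SE6 cycleEquiv_mem hcyc) hn))
  · exact isStandardWhite_of_two_ne_zero hW hn

theorem isStandardWhite_of_off_ne_zero {W : Albert F} (hW : albertSharp W = 0)
    (h : albertOff W 0 ≠ 0) : IsStandardWhite W := by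
  by_cases hd : ∃ n, W (Sum.inl n) ≠ 0
  · exact isStandardWhite_of_diag_ne_zero hW hd
  · push Not at hd
    -- With a zero diagonal, a transvection puts the polar value of A and x in the place of b, so
    -- any x not orthogonal to A produces a nonzero diagonal entry.
    obtain ⟨x, hx⟩ : ∃ x, octPolar (albertOff W 0) x ≠ 0 := by
      by_contra! hx
      exact h (octPolar_nondegenerate hx)
    refine .of_map (transvectionEquiv_mem x) (isStandardWhite_of_diag_ne_zero
      (albertSharp_eq_zero_of_mem_SE6 (transvectionEquiv_mem x) hW) ⟨1, ?_⟩)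
    change W (Sum.inl 1) + octPolar (albertOff W 0) x + W (Sum.inl 2) * octNorm x ≠ 0
    rwa [hd, hd, zero_add, zero_mul, add_zero]

/-- The group is transitive on white points. -/
theorem IsWhite.isStandardWhite {W : Albert F} (hW : IsWhite W) : IsStandardWhite W := by
  have hs := hW.albertSharp_eq_zero
  have hcyc := albertSharp_eq_zero_of_mem_SE6 cycleEquiv_mem hs
  by_cases hd : ∃ n, W (Sum.inl n) ≠ 0
  · exact isStandardWhite_of_diag_ne_zero hs hd
  by_cases h0 : albertOff W 0 = 0
  · by_cases h1 : albertOff W 1 = 0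
    · by_cases h2 : albertOff W 2 = 0
      · push Not at hd
        exact absurd (albert_ext hd h0 h1 h2) hW.1
      · exact .of_map cycleEquiv_mem (.of_map cycleEquiv_mem (isStandardWhite_of_off_ne_zero
          (albertSharp_eq_zero_of_mem_SE6 cycleEquiv_mem hcyc) h2))
    · exact .of_map cycleEquiv_mem (isStandardWhite_of_off_ne_zero hcyc h1)
  · exact isStandardWhite_of_off_ne_zero hs h0

/-- The action of the stabilizer of a white point, conjugated to the standard white point. -/
theorem nonempty_whiteAction {P : Submodule F (Albert F)} (hP : IsWhitePoint P) :
    Nonempty (WhiteAction F (SE6Stabilizer P)) := by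
  obtain ⟨W, hW, rfl⟩ := hP
  obtain ⟨g, hg, c, hc, e⟩ := hW.isStandardWhite
  let ι : SE6Stabilizer (Submodule.span F {W}) →* (Albert F ≃ₗ[F] Albert F) :=
    (SE6 F).subtype.comp (SE6Stabilizer (Submodule.span F {W})).subtype
  have hι : Function.Injective ι :=
    (SE6 F).subtype_injective.comp (SE6Stabilizer _).subtype_injective
  refine ⟨⟨(MulAut.conj g⁻¹).toMonoidHom.comp ι, (MulAut.conj g⁻¹).injective.comp hι,
    fun s X => ?_, fun s => ?_⟩⟩
  · refine albertDet_of_mem_SE6 ?_ X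
    change g⁻¹ * ι s * g⁻¹⁻¹ ∈ SE6 F
    exact mul_mem (mul_mem (inv_mem hg) s.1.2) (inv_mem (inv_mem hg))
  · have hs : (Submodule.span F {W}).map (ι s).toLinearMap = Submodule.span F {W} := s.2
    have hW' : ι s W ∈ Submodule.span F {W} :=
      hs.le (Submodule.mem_map_of_mem (Submodule.mem_span_singleton_self W))
    obtain ⟨d, hd⟩ := Submodule.mem_span_singleton.mp hW'
    refine ⟨d, ?_⟩
    change (g⁻¹ * ι s * g⁻¹⁻¹) (whiteVec F) = _
    rw [inv_inv, LinearEquiv.mul_apply, LinearEquiv.mul_apply, e, map_smul, ← hd, smul_comm, ← e,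
      map_smul]
    exact congrArg _ (g.symm_apply_apply _)

end Group

end Transitivity

theorem mainTheorem6 {F : Type*} [Field F] [Finite F] (P : Submodule F (Albert F))
    (hP : IsWhitePoint P) :
    (∃ (N₁ N₂ : Subgroup (SE6Stabilizer P)) (_ : N₁.Normal) (_ : N₂.Normal),
      N₁ ≤ N₂ ∧
      (∃ α : N₁ →* Multiplicative (Fin 16 → F), Function.Injective α) ∧
      (∃ β : (N₂ ⧸ N₁.subgroupOf N₂) →* Multiplicative (ZMod (Nat.card F - 1)),
        Function.Injective β) ∧
      Nat.card (SE6Stabilizer P ⧸ N₂) ≤ Nat.card (SO10 F) ∧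
      (ringChar F = 2 →
        ∃ γ : (SE6Stabilizer P ⧸ N₂) →* SO10 F, Function.Injective γ) ∧
      (ringChar F ≠ 2 →
        ∃ γ : (SE6Stabilizer P ⧸ N₂) →* PGSO10 F, Function.Injective γ)) ∧
    Nat.card (SE6Stabilizer P) ≤
      Nat.card F ^ 16 * (Nat.card F - 1) * Nat.card (SO10 F) := by
  obtain ⟨S⟩ := nonempty_whiteAction hP
  exact S.structure_of_stabilizer
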